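/- Let $k$ be a field. Let $\mathcal{H}sc_1$ be the non-symmetric operad in $k$-vector spaces with two colors $\{c,o\}$ (closed, open) presented by the generating operations (all in degree $0$) $$\mu\in\mathcal{H}sc_1(c,c;c),\qquad \rho\in\mathcal{H}sc_1(c,o;o),\qquad f\in\mathcal{H}sc_1(c;o)$$ and the quadratic relations $$\mu\circ_1\mu=\mu\circ_2\mu,\qquad \rho\circ_1\mu=\rho\circ_2\rho,\qquad f\circ_1\mu=\rho\circ_2 f .$$ (So an $\mathcal{H}sc_1$-algebra is a pair $(A,V)$ of an associative algebra $A$ and a left $A$-module $V$ with a linear map $f:A\to V$ such that $f(ab)=a\,f(b)$.) Then the quadratic operad $\mathcal{H}sc_1$ is Koszul. Here, for a quadratic non-symmetric colored operad $P=\mathcal F(E)/(R)$, where $E$ is in degree $0$, the Koszul dual cooperad $P^{¡}$ is the largest sub-cooperad of the cofree conilpotent cooperad $\mathcal F^c(sE)$ whose weight $2$ part is contained in $s^2R$, and $P$ is Koszul if its Koszul complex is acyclic, i.e. if the homology of $(P^{¡}\circ P, d_\kappa)$ is the identity operad, where $d_\kappa$ is induced by the twisting morphism $\kappa:P^{¡}\twoheadrightarrow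 sE\cong E\hookrightarrow P$. -/

import Mathlib

/-!  Koszul duality for quadratic non-symmetric coloured operads over a field, and the two-coloured
operad of affine actions.

Conventions.  `S` is the set of colours.  A family `E : List S → S → Type` is a (chosen basis of an)
`S`-graded vector space of generating operations: `E I s` is the set of generators with sequence of
input colours `I` and output colour `s`.  All generators have degree `0`, so their suspensions have
degree `1` and signs are produced by the Koszul rule alone. -/

noncomputable section

namespace NSKoszul

universe u v

/-! ### Planar trees -/

/-- Planar coloured trees with root colour `s`, vertices labelled by generating operations and
leaves of colour `c` labelled by elements of `X c`. -/
inductive Tree {S : Type v} (E : List S → S → Type) (X : S → Type v) : S → Type v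
  | leaf {s : S} (x : X s) : Tree E X s
  | node {I : List S} {s : S} (g : E I s) (t : (i : Fin I.length) → Tree E X (I.get i)) :
      Tree E X s

/-- Planar coloured trees without labels on the leaves.  They form a basis of the free
non-symmetric coloured operad `F(E)`; those with sequence of leaf colours `I` form a basis of its
component `F(E)(I; s)`.  With the vertices suspended, and the tensor product over the vertices
ordered by first visit from the root, left to right, they also form a basis of the cofree
conilpotent cooperad `Fᶜ(sE)`. -/
abbrev PTree {S : Type v} (E : List S → S → Type) (s : S) : Type v :=
  Tree E (fun _ => PUnit.{v + 1}) s

namespace Tree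

variable {S : Type v} {E : List S → S → Type} {X Y : S → Type v}

/-- The weight: the number of vertices. -/
def weight : {s : S} → Tree E X s → ℕ
  | _, leaf _ => 0
  | _, node _ t => 1 + ∑ i, (t i).weight

/-- The colours of the leaves, from left to right. -/
def leaves : {s : S} → Tree E X s → List S
  | s, leaf _ => [s]
  | _, node _ t => (List.ofFn fun i => (t i).leaves).flatten

/-- The number of leaves of the children `t j` standing to the left of the child `t i`. -/
def offset {I : List S} (t : (i : Fin I.length) → Tree E X (I.get i)) (i : Fin I.length) : ℕ :=
  ∑ j ∈ Finset.Iio i, (t j).leaves.length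

/-- The operadic composite `τ(u₀, u₁, …)`: the leaf number `m` (from left to right, from `0`) of
`τ`, of colour `c`, is replaced by the tree `u m c`. -/
def subst : {s : S} → Tree E Y s → (ℕ → (c : S) → Tree E X c) → Tree E X s
  | s, leaf _, u => u 0 s
  | _, node g t, u => node g fun i => (t i).subst fun m => u (offset t i + m)

/-- The total weight of the trees grafted on the leaves of `τ` in `τ(u₀, u₁, …)`. -/
def labelWeight : {s : S} → Tree E Y s → (ℕ → (c : S) → Tree E X c) → ℕ
  | s, leaf _, u => (u 0 s).weight
  | _, node _ t, u => ∑ i, (t i).labelWeight fun m => u (offset t i + m)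

/-- The exponent of the Koszul sign of the permutation of vertices, all of degree `1`, that takes
`τ ⊗ u₀ ⊗ u₁ ⊗ ⋯` to the tree `τ(u₀, u₁, …)`: the number of pairs of a vertex `v` of `τ` and a
vertex `w` of some `u m` such that `w` is visited before `v` in `τ(u₀, u₁, …)`. -/
def crossings : {s : S} → Tree E Y s → (ℕ → (c : S) → Tree E X c) → ℕ
  | _, leaf _, _ => 0
  | _, node _ t, u =>
      ∑ i, ((t i).crossings (fun m => u (offset t i + m)) +
        (t i).weight * ∑ j ∈ Finset.Iio i, (t j).labelWeight fun m => u (offset t j + m))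

/-- Grafting a tree whose leaves are labelled by trees: two-level trees give trees. -/
def join : {s : S} → Tree E (PTree E) s → PTree E s
  | _, leaf x => x
  | _, node g t => node g fun i => (t i).join

end Tree

/-- Trees with root colour `s` and with one hole, of colour `c`.  (In `node g i t C` the hole is in
the `i`-th child, which is `C`; the value `t i` is not used.) -/
inductive Context {S : Type v} (E : List S → S → Type) (X : S → Type v) (c : S) : S → Type v
  | hole : Context E X c c
  | node {I : List S} {s : S} (g : E I s) (i : Fin I.length)
      (t : (j : Fin I.length) → Tree E X (I.get j)) (C : Context E X c (I.get i)) :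
      Context E X c s

/-- Filling the hole of a context. -/
def Context.plug {S : Type v} {E : List S → S → Type} {X : S → Type v} {c : S} :
    {s : S} → Context E X c s → Tree E X c → Tree E X s
  | _, .hole, w => w
  | _, .node g i t C, w => .node g (Function.update t i (C.plug w))

/-! ### Quadratic data, the quadratic operad and its Koszul dual cooperad -/

/-- Quadratic data `(E, R)`: generating operations `E`, and for every profile `(I; s)` a space of
relations `R(I; s)` inside the weight two part of the free operad component `F(E)(I; s)`. -/
structure QuadraticData (k : Type u) [Field k] (S : Type v) where
  /-- the generating operations with given input colours and output colour -/
  E : List S → S → Type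
  /-- the space of relations with given input colours and output colour -/
  R : (I : List S) → (s : S) → Submodule k (PTree E s →₀ k)
  /-- the relations are quadratic and have the given inputs -/
  R_le : ∀ I s, R I s ≤ Finsupp.supported k k {t : PTree E s | t.leaves = I ∧ t.weight = 2}

namespace QuadraticData

variable {k : Type u} [Field k] {S : Type v} (Q : QuadraticData k S)

/-- The operadic ideal `(R)` of the free operad `F(E)` (operations with output `s`): it is spanned
by the composites `C ∘ r ∘ (u₀, u₁, …)` where a relation `r` has its inputs composed with trees and
is itself composed into a leaf of a tree.  The quadratic operad is `P(E, R) = F(E)/(R)`. -/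
def ideal (s : S) : Submodule k (PTree Q.E s →₀ k) :=
  Submodule.span k {y | ∃ (I : List S) (c : S) (r : PTree Q.E c →₀ k)
    (C : Context Q.E (fun _ => PUnit) c s) (u : ℕ → (c : S) → PTree Q.E c),
    r ∈ Q.R I c ∧ y = r.mapDomain fun t => C.plug (t.subst u)}

/-- The quadratic operad `P(E, R) = F(E)/(R)`, all operations with output colour `s` together. -/
abbrev Operad (s : S) : Type (max u v) := (PTree Q.E s →₀ k) ⧸ Q.ideal s

/-- The component `C(sE, s²R)(I; s)` of the Koszul dual cooperad `P^¡`, the largest sub-cooperad of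
`Fᶜ(sE)` whose weight two part is contained in `s²R`.  An element `x` of `Fᶜ(sE)(I; s)` belongs to
it when, for every way of cutting out a subtree with two vertices (the rest being `C` below it and
`u₀, u₁, …` above it), the corresponding component of the decomposition of `x` is a relation. -/
def koszulDual (I : List S) (s : S) : Submodule k (PTree Q.E s →₀ k) where
  carrier := {x | x ∈ Finsupp.supported k k {t : PTree Q.E s | t.leaves = I} ∧
    ∀ (J : List S) (c : S) (C : Context Q.E (fun _ => PUnit) c s)
      (u : ℕ → (c : S) → PTree Q.E c),
      ∃ r ∈ Q.R J c, ∀ t : PTree Q.E c, t.leaves = J → t.weight = 2 →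
        r t = (-1) ^ t.crossings u * x (C.plug (t.subst u))}
  zero_mem' := ⟨Submodule.zero_mem _, fun J c C u => ⟨0, Submodule.zero_mem _, by simp⟩⟩
  add_mem' := by
    rintro x y ⟨hx, hx'⟩ ⟨hy, hy'⟩
    refine ⟨Submodule.add_mem _ hx hy, fun J c C u => ?_⟩
    obtain ⟨r, hr, h⟩ := hx' J c C u
    obtain ⟨r', hr', h'⟩ := hy' J c C u
    refine ⟨r + r', Submodule.add_mem _ hr hr', fun t ht hw => ?_⟩
    rw [Finsupp.add_apply, Finsupp.add_apply, h t ht hw, h' t ht hw, mul_add]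
  smul_mem' := by
    rintro a x ⟨hx, hx'⟩
    refine ⟨Submodule.smul_mem _ a hx, fun J c C u => ?_⟩
    obtain ⟨r, hr, h⟩ := hx' J c C u
    refine ⟨a • r, Submodule.smul_mem _ a hr, fun t ht hw => ?_⟩
    rw [Finsupp.smul_apply, Finsupp.smul_apply, h t ht hw, smul_eq_mul, smul_eq_mul,
      mul_left_comm]

/-! ### The Koszul complex -/

/-- Two-level trees: trees with vertices in `sE`, whose leaves are labelled by trees with vertices
in `E`.  They form a basis of the composite product `Fᶜ(sE) ∘ F(E)`. -/
abbrev Tree₂ (s : S) : Type v := Tree Q.E (PTree Q.E) s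

/-- The subspace `Fᶜ(sE) ∘ (R)` of `Fᶜ(sE) ∘ F(E)`, spanned by the two-level trees with one label an
element of the ideal `(R)` (expanded linearly) and the other labels trees. -/
def idealLabels (s : S) : Submodule k (Q.Tree₂ s →₀ k) :=
  Submodule.span k {y | ∃ (c : S) (C : Context Q.E (PTree Q.E) c s), ∃ r ∈ Q.ideal c,
    y = r.mapDomain fun t => C.plug (Tree.leaf t)}

/-- The composite product `Fᶜ(sE) ∘ P`, where `P = F(E)/(R)`. -/
abbrev Comp (s : S) : Type (max u v) := (Q.Tree₂ s →₀ k) ⧸ Q.idealLabels s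

/-- The operator `d_κ` on a two-level tree: the sum over the lower vertices `v` with no lower vertex
above them of `(-1)^(number of lower vertices visited before v)` times the two-level tree where `v`,
desuspended by `κ : P^¡ → sE → E → P`, has been composed with the labels above it. -/
def diffTree : {s : S} → Q.Tree₂ s → (Q.Tree₂ s →₀ k)
  | _, .leaf _ => 0
  | _, .node g t =>
      (if ∀ i, (t i).weight = 0 then
        Finsupp.single (.leaf (.node g fun i => (t i).join)) 1 else 0) +
      ∑ i, (-1 : k) ^ (1 + ∑ j ∈ Finset.Iio i, (t j).weight) •
        (diffTree (t i)).mapDomain fun w => .node g (Function.update t i w)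

/-- The operator `d_κ` on `Fᶜ(sE) ∘ F(E)`. -/
def diffFree (s : S) : (Q.Tree₂ s →₀ k) →ₗ[k] (Q.Tree₂ s →₀ k) :=
  Finsupp.linearCombination k Q.diffTree

/-- The ideal `(R)` is stable under composition into a leaf of a tree with one vertex. -/
theorem ideal_node {I : List S} {s : S} (g : Q.E I s) (t : (j : Fin I.length) → PTree Q.E (I.get j))
    (i : Fin I.length) {x : PTree Q.E (I.get i) →₀ k} (hx : x ∈ Q.ideal (I.get i)) :
    (x.mapDomain fun v => (Tree.node g (Function.update t i v) : PTree Q.E s)) ∈ Q.ideal s := by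
  induction hx using Submodule.span_induction with
  | mem y hy =>
    obtain ⟨J, c, r, C, u, hr, rfl⟩ := hy
    rw [← Finsupp.mapDomain_comp]
    exact Submodule.subset_span ⟨J, c, r, .node g i t C, u, hr, rfl⟩
  | zero => simp
  | add y z _ _ hy hz => rw [Finsupp.mapDomain_add]; exact Submodule.add_mem _ hy hz
  | smul a y _ hy => rw [Finsupp.mapDomain_smul]; exact Submodule.smul_mem _ a hy

/-- `Fᶜ(sE) ∘ (R)` is stable under grafting on a lower vertex. -/
theorem idealLabels_node {I : List S} {s : S} (g : Q.E I s)
    (t : (j : Fin I.length) → Q.Tree₂ (I.get j))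
    (i : Fin I.length) {x : Q.Tree₂ (I.get i) →₀ k} (hx : x ∈ Q.idealLabels (I.get i)) :
    (x.mapDomain fun v => (Tree.node g (Function.update t i v) : Q.Tree₂ s)) ∈
      Q.idealLabels s := by
  induction hx using Submodule.span_induction with
  | mem y hy =>
    obtain ⟨c, C, r, hr, rfl⟩ := hy
    rw [← Finsupp.mapDomain_comp]
    exact Submodule.subset_span ⟨c, .node g i t C, r, hr, rfl⟩
  | zero => simp
  | add y z _ _ hy hz => rw [Finsupp.mapDomain_add]; exact Submodule.add_mem _ hy hz
  | smul a y _ hy => rw [Finsupp.mapDomain_smul]; exact Submodule.smul_mem _ a hy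

theorem weight_plug {c s : S} (C : Context Q.E (PTree Q.E) c s) (v w : PTree Q.E c) :
    (C.plug (Tree.leaf v)).weight = (C.plug (Tree.leaf w)).weight := by
  induction C with
  | hole => rfl
  | node g i t C ih =>
    simp only [Context.plug, Tree.weight]
    congr 1
    refine Finset.sum_congr rfl fun j _ => ?_
    by_cases h : j = i
    · subst h; simpa using ih
    · simp [Function.update_of_ne h]

theorem join_plug_ideal {c s : S} (C : Context Q.E (PTree Q.E) c s) {x : PTree Q.E c →₀ k}
    (hx : x ∈ Q.ideal c) :
    (x.mapDomain fun v => (C.plug (Tree.leaf v)).join) ∈ Q.ideal s := by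
  induction C with
  | hole =>
    change Finsupp.mapDomain id x ∈ _
    rwa [Finsupp.mapDomain_id]
  | @node I s g i t C ih =>
    have h := Q.ideal_node g (fun j => (t j).join) i ih
    rw [← Finsupp.mapDomain_comp] at h
    convert h using 2
    funext v
    simp only [Context.plug, Tree.join, Function.comp_apply]
    congr 1
    funext j
    by_cases hj : j = i
    · subst hj; simp
    · simp [Function.update_of_ne hj]

/-- `d_κ` preserves `Fᶜ(sE) ∘ (R)`, hence acts on `Fᶜ(sE) ∘ P`. -/
theorem diffFree_idealLabels (s : S) : Q.idealLabels s ≤ (Q.idealLabels s).comap (Q.diffFree s) := by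
  refine Submodule.span_le.2 ?_
  rintro _ ⟨c, C, x, hx, rfl⟩
  simp only [Submodule.comap_coe, Set.mem_preimage, SetLike.mem_coe]
  induction C with
  | hole =>
    simp only [Context.plug, diffFree]
    rw [Finsupp.linearCombination_mapDomain]
    have : (Q.diffTree ∘ fun t : PTree Q.E c => (Tree.leaf t : Q.Tree₂ c)) = fun _ => 0 := rfl
    rw [this]
    simp [Finsupp.linearCombination_apply]
  | @node I s g i t C ih =>
    simp only [diffFree] at ih ⊢
    rw [Finsupp.linearCombination_mapDomain, Finsupp.linearCombination_apply] at ih ⊢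
    simp only [Function.comp_apply, Context.plug, diffTree, smul_add, Finset.smul_sum]
    rw [Finsupp.sum_add]
    refine Submodule.add_mem _ ?_ ?_
    · have hw : ∀ v, (∀ j, (Function.update t i (C.plug (Tree.leaf v)) j).weight = 0) ↔
          ∀ j, (Function.update t i (C.plug (Tree.leaf (Tree.leaf PUnit.unit))) j).weight = 0 := by
        intro v
        refine forall_congr' fun j => ?_
        by_cases hj : j = i
        · subst hj; simp [Q.weight_plug C v (Tree.leaf PUnit.unit)]
        · simp [Function.update_of_ne hj]
      simp only [hw]
      split_ifs with h0
      · refine Submodule.subset_span ⟨s, .hole, _, Q.join_plug_ideal (.node g i t C) hx, ?_⟩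
        rw [← Finsupp.mapDomain_comp, Finsupp.mapDomain]
        refine Finsupp.sum_congr fun v _ => ?_
        simp [Context.plug, Tree.join]
      · simp [Finsupp.sum]
    · rw [Finsupp.sum, Finset.sum_comm]
      refine Submodule.sum_mem _ fun j _ => ?_
      by_cases hj : j = i
      · subst hj
        have h := Submodule.smul_mem _ ((-1 : k) ^ (1 + ∑ l ∈ Finset.Iio j, (t l).weight))
          (Q.idealLabels_node g t j ih)
        convert h using 1
        rw [Finsupp.sum, Finsupp.mapDomain_finsetSum, Finset.smul_sum]
        refine Finset.sum_congr rfl fun v _ => ?_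
        have h1 : ∑ l ∈ Finset.Iio j, (Function.update t j (C.plug (Tree.leaf v)) l).weight =
            ∑ l ∈ Finset.Iio j, (t l).weight :=
          Finset.sum_congr rfl fun l hl => by
            rw [Function.update_of_ne (Finset.mem_Iio.1 hl).ne]
        rw [h1, Function.update_self, Finsupp.mapDomain_smul, smul_comm]
        simp only [Function.update_idem]
        rfl
      · have h1 : ∀ v, ∑ l ∈ Finset.Iio j, (Function.update t i (C.plug (Tree.leaf v)) l).weight =
            ∑ l ∈ Finset.Iio j,
              (Function.update t i (C.plug (Tree.leaf (Tree.leaf PUnit.unit))) l).weight := by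
          intro v
          refine Finset.sum_congr rfl fun l _ => ?_
          by_cases hl : l = i
          · subst hl; simp [Q.weight_plug C v (Tree.leaf PUnit.unit)]
          · simp [Function.update_of_ne hl]
        simp only [h1, Function.update_of_ne hj]
        simp only [smul_comm _ ((-1 : k) ^ _) _]
        rw [← Finset.smul_sum]
        refine Submodule.smul_mem _ _ ?_
        simp only [Finsupp.mapDomain, Finsupp.sum, Finset.smul_sum]
        rw [Finset.sum_comm]
        refine Submodule.sum_mem _ fun w _ => ?_
        have h := Submodule.smul_mem _ (diffTree Q (t j) w)
          (Submodule.subset_span ⟨c, .node g i (Function.update t j w) C, x, hx, rfl⟩ :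
            x.mapDomain (fun v => (Context.node g i (Function.update t j w) C).plug
              (Tree.leaf v)) ∈ Q.idealLabels s)
        refine (congrArg (fun y => y ∈ Q.idealLabels s) ?_).mpr h
        simp only [Finsupp.mapDomain, Finsupp.sum, Finset.smul_sum]
        refine Finset.sum_congr rfl fun v _ => ?_
        simp only [Context.plug, Finsupp.smul_single, smul_eq_mul]
        rw [Function.update_comm hj, mul_comm]

/-- The operator `d_κ` on `Fᶜ(sE) ∘ P`. -/
def diff (s : S) : Q.Comp s →ₗ[k] Q.Comp s :=
  (Q.idealLabels s).mapQ (Q.idealLabels s) (Q.diffFree s) (Q.diffFree_idealLabels s)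

/-- The Koszul complex `P^¡ ∘_κ P` (all its operations with output `s` together), as a subspace of
`Fᶜ(sE) ∘ P` with differential `d_κ`: it is spanned by the elements `x ⊗ (p₀ ⊗ p₁ ⊗ ⋯)` with `x` in a
component `P^¡(I; s)` and with `p_m` the class in `P` of a tree `u m` with the colour of the `m`-th
input of `x` as output. -/
def koszulComplex (s : S) : Submodule k (Q.Comp s) :=
  Submodule.span k {y | ∃ (I : List S), ∃ x ∈ Q.koszulDual I s, ∃ u : ℕ → (c : S) → PTree Q.E c,
    y = (Q.idealLabels s).mkQ
      (x.mapDomain fun t => t.subst fun m c => (Tree.leaf (u m c) : Q.Tree₂ c))}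

/-- The identity `id ⊗ id` of colour `s` in `P^¡ ∘ P`, spanning the unit `I` of the composite
product. -/
def unit (s : S) : Q.Comp s :=
  (Q.idealLabels s).mkQ (Finsupp.single (Tree.leaf (Tree.leaf PUnit.unit)) 1)

/-- The operad `P(E, R)` is Koszul when its Koszul complex `P^¡ ∘_κ P` is acyclic, that is, when the
homology of the Koszul complex is the identity operad `I`: every cycle is, for exactly one scalar
`a`, the sum of `a` times the identity and a boundary. -/
def IsKoszul : Prop :=
  ∀ (s : S), ∀ z ∈ Q.koszulComplex s, Q.diff s z = 0 →
    ∃! a : k, ∃ y ∈ Q.koszulComplex s, z = a • Q.unit s + Q.diff s y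

end QuadraticData

/-! ### The operad of affine actions -/

/-- The two colours: closed and open. -/
inductive Colour
  | cl
  | op

namespace HSC₁

open Colour

/-- The generating operations `μ ∈ (cl, cl; cl)`, `ρ ∈ (cl, op; op)` and `f ∈ (cl; op)`. -/
inductive Gen : List Colour → Colour → Type
  | mu : Gen [cl, cl] cl
  | rho : Gen [cl, op] op
  | f : Gen [cl] op

/-- The tree with no vertex: the identity operation. -/
def one (c : Colour) : PTree Gen c := .leaf PUnit.unit

/-- The composite `μ(a, b)`. -/
def mu (a b : PTree Gen cl) : PTree Gen cl :=
  .node .mu fun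
    | ⟨0, _⟩ => a
    | ⟨1, _⟩ => b

/-- The composite `ρ(a, v)`. -/
def rho (a : PTree Gen cl) (v : PTree Gen op) : PTree Gen op :=
  .node .rho fun
    | ⟨0, _⟩ => a
    | ⟨1, _⟩ => v

/-- The composite `f(a)`. -/
def f (a : PTree Gen cl) : PTree Gen op :=
  .node .f fun
    | ⟨0, _⟩ => a

/-- The three quadratic relations `μ ∘₁ μ - μ ∘₂ μ`, `ρ ∘₁ μ - ρ ∘₂ ρ` and `f ∘₁ μ - ρ ∘₂ f`. -/
def relations (k : Type u) [Field k] : (I : List Colour) → (s : Colour) → Set (PTree Gen s →₀ k)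
  | [cl, cl, cl], cl =>
      {Finsupp.single (mu (mu (one cl) (one cl)) (one cl)) 1 -
        Finsupp.single (mu (one cl) (mu (one cl) (one cl))) 1}
  | [cl, cl, op], op =>
      {Finsupp.single (rho (mu (one cl) (one cl)) (one op)) 1 -
        Finsupp.single (rho (one cl) (rho (one cl) (one op))) 1}
  | [cl, cl], op =>
      {Finsupp.single (f (mu (one cl) (one cl))) 1 -
        Finsupp.single (rho (one cl) (f (one cl))) 1}
  | _, _ => ∅

theorem relations_subset (k : Type u) [Field k] (I : List Colour) (s : Colour) :
    relations k I s ⊆ Finsupp.supported k k {t : PTree Gen s | t.leaves = I ∧ t.weight = 2} := by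
  intro x hx
  unfold relations at hx
  split at hx
  · rw [Set.mem_singleton_iff.1 hx]
    exact Submodule.sub_mem _ (Finsupp.single_mem_supported _ _ ⟨rfl, rfl⟩)
      (Finsupp.single_mem_supported _ _ ⟨rfl, rfl⟩)
  · rw [Set.mem_singleton_iff.1 hx]
    exact Submodule.sub_mem _ (Finsupp.single_mem_supported _ _ ⟨rfl, rfl⟩)
      (Finsupp.single_mem_supported _ _ ⟨rfl, rfl⟩)
  · rw [Set.mem_singleton_iff.1 hx]
    exact Submodule.sub_mem _ (Finsupp.single_mem_supported _ _ ⟨rfl, rfl⟩)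
      (Finsupp.single_mem_supported _ _ ⟨rfl, rfl⟩)
  · exact hx.elim

end HSC₁

open HSC₁ in
/-- The quadratic data presenting the operad `hsc₁ = F(μ, ρ, f)/(R)`. -/
def hsc₁ (k : Type u) [Field k] : QuadraticData k Colour where
  E := Gen
  R I s := Submodule.span k (relations k I s)
  R_le I s := Submodule.span_le.2 (relations_subset k I s)

end NSKoszul
end

/-! In both `P` and `P^¡` each sequence of inputs carries at most a line. Two trees with the same
leaves are joined by rewritings along the three relations (`rot_of_leaves_eq`), so the class of a
tree in `P` depends only on its weight and on whether its last input is open (its kind). Dually, the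
coefficients of an element of `P^¡` change by a prescribed sign along each rewriting, so the element
is a multiple of the signed sum of all trees of its profile (`mem_koszulDual_of_apply`,
`eq_smul_of_mem_koszulDual`). Hence the Koszul complex is spanned by signed sums whose labels matter
only through weight and kind, that is, by words of blocks (`koszul_cl`, `koszul_op`). A signed sum
contains one right comb, with coefficient 1; reading it off shows that the words are independent
(`readCl_wordClL`, `readOp_wordOpL`).

The generator `f` is absorbed by a formal marked point: if `f(a)` is written as `a` acting on the
point, then `f(ab) = a f(b)` becomes associativity of the action, and `ρ` and `f` are treated
together. The closed case is the algebra acting on itself.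

The differential of a signed sum merges two neighbouring labels, with alternating signs
(`IsTwisted.d_actSum`). On words this is the normalized bar complex `B(k, k[x], k[x])`: a block with
`m` multiplications stands for `x^(m+1)`, a last block `m` for `x^m`. Splitting one `x` off the
first letter contracts it onto the empty word (`Word.d_h_add_h_d`), which is the unit. For open
output there are two copies, one for each kind. In the copy ending at the marked point the empty
word is no operation; `Word.valid` leaves it out, and that copy is acyclic. -/

namespace NSKoszul

/-! ### Signed sums of all bracketings and their differential. -/

section Comb

variable {k A M : Type*} [CommRing k] [AddCommGroup A] [Module k A] [AddCommGroup M] [Module k M]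

/-- The shifted sequence. -/
def shift {T : Type*} (i : ℕ) (u : ℕ → T) : ℕ → T := fun m => u (i + m)

/-- The signed sum of all the ways of multiplying `u 0, …, u n`. -/
def assocSum (mul : A →ₗ[k] A →ₗ[k] A) : ℕ → (ℕ → A) → A
  | 0, u => u 0
  | n + 1, u => ∑ i : Fin (n + 1),
      (-1 : k) ^ (i : ℕ) • mul (assocSum mul i u) (assocSum mul (n - i) (shift (i + 1) u))

/-- The signed sum of all the ways of letting `u 0, …, u (n - 1)` act on `e`. -/
def actSum (mulA : A →ₗ[k] A →ₗ[k] A) (mul : A →ₗ[k] M →ₗ[k] M) : ℕ → (ℕ → A) → M → M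
  | 0, _, e => e
  | n + 1, u, e => ∑ i : Fin (n + 1),
      (-1 : k) ^ (i : ℕ) • mul (assocSum mulA i u) (actSum mulA mul (n - i) (shift (i + 1) u) e)

variable (mulA : A →ₗ[k] A →ₗ[k] A) (mul : A →ₗ[k] M →ₗ[k] M)

@[simp] theorem assocSum_zero (u : ℕ → A) : assocSum mulA 0 u = u 0 := by rw [assocSum]

@[simp] theorem actSum_zero (u : ℕ → A) (e : M) : actSum mulA mul 0 u e = e := by rw [actSum]

theorem assocSum_succ (n : ℕ) (u : ℕ → A) : assocSum mulA (n + 1) u =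
    ∑ p ∈ Finset.HasAntidiagonal.antidiagonal n,
      (-1 : k) ^ p.1 • mulA (assocSum mulA p.1 u) (assocSum mulA p.2 (shift (p.1 + 1) u)) := by
  rw [assocSum, Finset.Nat.sum_antidiagonal_eq_sum_range_succ (fun i j =>
    (-1 : k) ^ i • mulA (assocSum mulA i u) (assocSum mulA j (shift (i + 1) u))),
    Finset.sum_range]

theorem actSum_succ (n : ℕ) (u : ℕ → A) (e : M) : actSum mulA mul (n + 1) u e =
    ∑ p ∈ Finset.HasAntidiagonal.antidiagonal n,
      (-1 : k) ^ p.1 • mul (assocSum mulA p.1 u) (actSum mulA mul p.2 (shift (p.1 + 1) u) e) := by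
  rw [actSum, Finset.Nat.sum_antidiagonal_eq_sum_range_succ (fun i j =>
    (-1 : k) ^ i • mul (assocSum mulA i u) (actSum mulA mul j (shift (i + 1) u) e)),
    Finset.sum_range]

theorem add_eq_of_mem_antidiagonal {n : ℕ} {p : ℕ × ℕ}
    (hp : p ∈ Finset.HasAntidiagonal.antidiagonal n) :
    p.1 + p.2 = n := Finset.HasAntidiagonal.mem_antidiagonal.1 hp

/-- A product of `n + 1` factors is an action of the first `n` on the last one; this is how the
closed case is reduced to the case of a module. -/
theorem assocSum_eq_actSum (n : ℕ) (u : ℕ → A) :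
    assocSum mulA n u = actSum mulA mulA n u (u n) := by
  induction n using Nat.strong_induction_on generalizing u with
  | _ n ih =>
    cases n with
    | zero => simp
    | succ n =>
      rw [assocSum_succ, actSum_succ]
      refine Finset.sum_congr rfl fun p hp => ?_
      have := add_eq_of_mem_antidiagonal hp
      rw [ih p.2 (by omega)]
      congr 3
      simp only [shift]
      congr 1
      omega

/-- Congruence of `assocSum` modulo a submodule stable under multiplication. -/
theorem assocSum_sub_mem {N : Submodule k A} (h₁ : ∀ x ∈ N, ∀ y, mulA x y ∈ N)
    (h₂ : ∀ x, ∀ y ∈ N, mulA x y ∈ N) (n : ℕ) (u u' : ℕ → A)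
    (hu : ∀ m ≤ n, u m - u' m ∈ N) : assocSum mulA n u - assocSum mulA n u' ∈ N := by
  induction n using Nat.strong_induction_on generalizing u u' with
  | _ n ih =>
    cases n with
    | zero => simpa using hu 0 le_rfl
    | succ n =>
      rw [assocSum_succ, assocSum_succ, ← Finset.sum_sub_distrib]
      refine Submodule.sum_mem _ fun p hp => ?_
      have := add_eq_of_mem_antidiagonal hp
      rw [← smul_sub]
      refine Submodule.smul_mem _ _ ?_
      have h3 := h₁ _ (ih p.1 (by omega) u u' fun m hm => hu m (by omega))
        (assocSum mulA p.2 (shift (p.1 + 1) u))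
      have h4 := h₂ (assocSum mulA p.1 u') _ (ih p.2 (by omega) (shift (p.1 + 1) u)
        (shift (p.1 + 1) u') fun m hm => hu _ (by omega))
      convert Submodule.add_mem _ h3 h4 using 1
      simp

/-- Congruence of `actSum` modulo submodules stable under multiplication. -/
theorem actSum_sub_mem {NA : Submodule k A} {N : Submodule k M}
    (hA₁ : ∀ x ∈ NA, ∀ y, mulA x y ∈ NA) (hA₂ : ∀ x, ∀ y ∈ NA, mulA x y ∈ NA)
    (h₁ : ∀ x ∈ NA, ∀ y, mul x y ∈ N) (h₂ : ∀ x, ∀ y ∈ N, mul x y ∈ N) (n : ℕ) (u u' : ℕ → A)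
    (e e' : M) (hu : ∀ m < n, u m - u' m ∈ NA) (he : e - e' ∈ N) :
    actSum mulA mul n u e - actSum mulA mul n u' e' ∈ N := by
  induction n using Nat.strong_induction_on generalizing u u' with
  | _ n ih =>
    cases n with
    | zero => simpa using he
    | succ n =>
      rw [actSum_succ, actSum_succ, ← Finset.sum_sub_distrib]
      refine Submodule.sum_mem _ fun p hp => ?_
      have := add_eq_of_mem_antidiagonal hp
      rw [← smul_sub]
      refine Submodule.smul_mem _ _ ?_
      have h3 := h₁ _ (assocSum_sub_mem mulA hA₁ hA₂ p.1 u u' fun m hm => hu m (by omega))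
        (actSum mulA mul p.2 (shift (p.1 + 1) u) e)
      have h4 := h₂ (assocSum mulA p.1 u') _ (ih p.2 (by omega) (shift (p.1 + 1) u)
        (shift (p.1 + 1) u') fun m hm => hu _ (by omega))
      convert Submodule.add_mem _ h3 h4 using 1
      simp

theorem assocSum_congr (n : ℕ) {u u' : ℕ → A} (hu : ∀ m ≤ n, u m = u' m) :
    assocSum mulA n u = assocSum mulA n u' :=
  sub_eq_zero.1 ((Submodule.mem_bot k).1 (assocSum_sub_mem mulA (N := ⊥)
    (by simp) (by simp) n u u' fun m hm => by simp [hu m hm]))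

/-- Merging the terms number `i` and `i + 1` of a sequence. -/
def mergeAt {T : Type*} (c : T → T → T) (i : ℕ) (t : ℕ → T) : ℕ → T :=
  fun m => if m < i then t m else if m = i then c (t i) (t (i + 1)) else t (m + 1)

theorem mergeAt_of_lt {T : Type*} (c : T → T → T) {i m : ℕ} (t : ℕ → T) (h : m < i) :
    mergeAt c i t m = t m := if_pos h

theorem mergeAt_self {T : Type*} (c : T → T → T) (i : ℕ) (t : ℕ → T) :
    mergeAt c i t i = c (t i) (t (i + 1)) := by simp [mergeAt]

theorem mergeAt_of_gt {T : Type*} (c : T → T → T) {i m : ℕ} (t : ℕ → T) (h : i < m) :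
    mergeAt c i t m = t (m + 1) := by
  simp [mergeAt, h.ne', not_lt.2 h.le]

theorem shift_mergeAt_of_le {T : Type*} (c : T → T → T) {i j : ℕ} (t : ℕ → T) (h : i < j) :
    shift j (mergeAt c i t) = shift (j + 1) t := by
  funext m
  simp only [shift]
  rw [mergeAt_of_gt c t (by omega)]
  congr 1
  omega

theorem shift_mergeAt_add {T : Type*} (c : T → T → T) (i j : ℕ) (t : ℕ → T) :
    shift j (mergeAt c (j + i) t) = mergeAt c i (shift j t) := by
  funext m
  simp only [shift, mergeAt, add_lt_add_iff_left, add_right_inj, add_assoc]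

variable {T End : Type*}

/-- Differentials of degree `-1` on `A` and `M` that are derivations up to sign except on the
product of two elements of weight zero, the products of labels being described by `c`. -/
structure IsTwisted (mul : A →ₗ[k] M →ₗ[k] M) (dA : A →ₗ[k] A) (dM : M →ₗ[k] M)
    (GA : ℕ → Submodule k A) (GM : ℕ → Submodule k M) (lab : T → A) (inc : End → M)
    (c : T → End → End) : Prop where
  lab_mem : ∀ t, lab t ∈ GA 0
  inc_mem : ∀ e, inc e ∈ GM 0
  d_lab : ∀ t, dA (lab t) = 0
  d_inc : ∀ e, dM (inc e) = 0
  mul_mem : ∀ i j, ∀ x ∈ GA i, ∀ y ∈ GM j, mul x y ∈ GM (i + j + 1)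
  d_mul_lab : ∀ t e, dM (mul (lab t) (inc e)) = inc (c t e)
  d_mul : ∀ i j, ∀ x ∈ GA i, ∀ y ∈ GM j, 0 < i + j →
    dM (mul x y) = -mul (dA x) y + (-1 : k) ^ (i + 1) • mul x (dM y)

variable {mulA mul} {dA : A →ₗ[k] A} {dM : M →ₗ[k] M}
    {GA : ℕ → Submodule k A} {GM : ℕ → Submodule k M} {lab : T → A} {inc : End → M}
    {cA : T → T → T} {c : T → End → End}

theorem IsTwisted.assocSum_mem (hA : IsTwisted mulA dA dA GA GA lab lab cA) (n : ℕ) (t : ℕ → T) :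
    assocSum mulA n (lab ∘ t) ∈ GA n := by
  induction n using Nat.strong_induction_on generalizing t with
  | _ n ih =>
    cases n with
    | zero => simpa using hA.lab_mem _
    | succ n =>
      rw [assocSum_succ]
      refine Submodule.sum_mem _ fun p hp => Submodule.smul_mem _ _ ?_
      have := add_eq_of_mem_antidiagonal hp
      rw [← this]
      exact hA.mul_mem _ _ _ (ih _ (by omega) _) _ (ih _ (by omega) (shift (p.1 + 1) t))

theorem IsTwisted.actSum_mem (hA : IsTwisted mulA dA dA GA GA lab lab cA)
    (h : IsTwisted mul dA dM GA GM lab inc c) (n : ℕ) (t : ℕ → T) (e : End) :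
    actSum mulA mul n (lab ∘ t) (inc e) ∈ GM n := by
  induction n using Nat.strong_induction_on generalizing t with
  | _ n ih =>
    cases n with
    | zero => simpa using h.inc_mem _
    | succ n =>
      rw [actSum_succ]
      refine Submodule.sum_mem _ fun p hp => Submodule.smul_mem _ _ ?_
      have := add_eq_of_mem_antidiagonal hp
      rw [← this]
      exact h.mul_mem _ _ _ (hA.assocSum_mem _ _) _ (ih _ (by omega) (shift (p.1 + 1) t))

/-- Every product is differentiated in its left or in its right factor. Conversely, once the merged
sequence is split at the root, the merged label lies in exactly one of the two factors, so every
term on the right arises once. The formula for the algebra is taken as the hypothesis `hP`, so that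
it can itself be deduced from the case `M = A`. -/
theorem IsTwisted.d_actSum_aux (hA : IsTwisted mulA dA dA GA GA lab lab cA)
    (h : IsTwisted mul dA dM GA GM lab inc c) (n : ℕ)
    (hP : ∀ i < n, ∀ t : ℕ → T, dA (assocSum mulA (i + 1) (lab ∘ t)) =
      ∑ l ∈ Finset.range (i + 1), (-1 : k) ^ l • assocSum mulA i (lab ∘ mergeAt cA l t))
    (t : ℕ → T) (e : End) :
    dM (actSum mulA mul (n + 1) (lab ∘ t) (inc e)) =
      ∑ l ∈ Finset.range n, (-1 : k) ^ l • actSum mulA mul n (lab ∘ mergeAt cA l t) (inc e) +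
        (-1 : k) ^ n • actSum mulA mul n (lab ∘ t) (inc (c (t n) e)) := by
  induction n using Nat.strong_induction_on generalizing t with
  | _ n ih =>
    cases n with
    | zero => simpa [actSum_succ] using h.d_mul_lab _ _
    | succ n =>
      have e1 : dM (actSum mulA mul (n + 1 + 1) (lab ∘ t) (inc e)) =
          ∑ p ∈ Finset.HasAntidiagonal.antidiagonal (n + 1), (-1 : k) ^ p.1 •
            (-mul (dA (assocSum mulA p.1 (lab ∘ t)))
                (actSum mulA mul p.2 (lab ∘ shift (p.1 + 1) t) (inc e)) +
              (-1 : k) ^ (p.1 + 1) • mul (assocSum mulA p.1 (lab ∘ t))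
                (dM (actSum mulA mul p.2 (lab ∘ shift (p.1 + 1) t) (inc e)))) := by
        rw [actSum_succ, map_sum]
        refine Finset.sum_congr rfl fun p hp => ?_
        have := add_eq_of_mem_antidiagonal hp
        rw [map_smul]
        congr 1
        -- The weights add up to `n + 1`, so the exceptional product of two elements of weight zero
        -- does not occur here.
        exact h.d_mul p.1 p.2 _ (hA.assocSum_mem _ _) _ (hA.actSum_mem h _ _ _) (by omega)
      rw [e1]
      simp only [smul_add, Finset.sum_add_distrib]
      -- A bare label on the left (`p.1 = 0`) and a bare end on the right (`p.2 = 0`) are cycles.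
      -- Peeling off these terms reindexes both sums over the antidiagonal of `n`.
      rw [Finset.Nat.sum_antidiagonal_succ, Finset.Nat.sum_antidiagonal_succ']
      have z1 : dA (assocSum mulA 0 (lab ∘ t)) = 0 := by simpa using h.d_lab _
      have z2 : ∀ u, dM (actSum mulA mul 0 u (inc e)) = 0 := by simpa using h.d_inc e
      simp only [z1, z2, map_zero, LinearMap.zero_apply, neg_zero, smul_zero, zero_add]
      have e2 : ∀ p ∈ Finset.HasAntidiagonal.antidiagonal n, (-1 : k) ^ (p.1 + 1) •
          -mul (dA (assocSum mulA (p.1 + 1) (lab ∘ t)))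
            (actSum mulA mul p.2 (lab ∘ shift (p.1 + 1 + 1) t) (inc e)) =
          ∑ l ∈ Finset.range (p.1 + 1), (-1 : k) ^ l • (-1 : k) ^ p.1 •
            mul (assocSum mulA p.1 (lab ∘ mergeAt cA l t))
            (actSum mulA mul p.2 (shift (p.1 + 1) (lab ∘ mergeAt cA l t)) (inc e)) := by
        intro p hp
        have := add_eq_of_mem_antidiagonal hp
        rw [hP p.1 (by omega), map_sum, LinearMap.sum_apply, ← Finset.sum_neg_distrib,
          Finset.smul_sum]
        refine Finset.sum_congr rfl fun l hl => ?_
        have hs : shift (p.1 + 1) (lab ∘ mergeAt cA l t) = lab ∘ shift (p.1 + 1 + 1) t := by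
          rw [← shift_mergeAt_of_le cA t (Finset.mem_range.1 hl)]; rfl
        rw [hs, map_smul, LinearMap.smul_apply, pow_succ, mul_neg_one, smul_neg, neg_smul, neg_neg,
          smul_comm]
      have e3 : ∀ p ∈ Finset.HasAntidiagonal.antidiagonal n, (-1 : k) ^ p.1 • (-1 : k) ^ (p.1 + 1) •
          mul (assocSum mulA p.1 (lab ∘ t))
            (dM (actSum mulA mul (p.2 + 1) (lab ∘ shift (p.1 + 1) t) (inc e))) =
          ∑ l ∈ Finset.range p.2, (-1 : k) ^ (p.1 + 1 + l) • (-1 : k) ^ p.1 •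
            mul (assocSum mulA p.1 (lab ∘ mergeAt cA (p.1 + 1 + l) t))
            (actSum mulA mul p.2 (shift (p.1 + 1) (lab ∘ mergeAt cA (p.1 + 1 + l) t)) (inc e)) +
          (-1 : k) ^ (n + 1) • (-1 : k) ^ p.1 • mul (assocSum mulA p.1 (lab ∘ t))
            (actSum mulA mul p.2 (shift (p.1 + 1) (lab ∘ t)) (inc (c (t (n + 1)) e))) := by
        intro p hp
        have hn := add_eq_of_mem_antidiagonal hp
        rw [ih p.2 (by omega) (fun i hi => hP i (by omega)), map_add, map_sum, smul_add, smul_add,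
          Finset.smul_sum, Finset.smul_sum]
        congr 1
        · refine Finset.sum_congr rfl fun l _ => ?_
          have hs : shift (p.1 + 1) (lab ∘ mergeAt cA (p.1 + 1 + l) t) =
              lab ∘ mergeAt cA l (shift (p.1 + 1) t) := by
            rw [← shift_mergeAt_add]; rfl
          have hc : assocSum mulA p.1 (lab ∘ mergeAt cA (p.1 + 1 + l) t) =
              assocSum mulA p.1 (lab ∘ t) :=
            assocSum_congr _ _ fun m hm => by
              simp only [Function.comp_apply]
              rw [mergeAt_of_lt _ _ (by omega)]
          rw [hs, hc, map_smul, smul_smul, smul_smul, smul_smul]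
          congr 1
          ring
        · have ht : shift (p.1 + 1) t p.2 = t (n + 1) := by
            simp only [shift]; congr 1; omega
          rw [ht, map_smul, smul_smul, smul_smul, smul_smul, ← hn]
          congr 1
          ring
      rw [Finset.sum_congr rfl e2, Finset.sum_congr rfl e3, Finset.sum_add_distrib, ← add_assoc,
        ← Finset.sum_add_distrib]
      congr 1
      · simp only [actSum_succ, Finset.smul_sum]
        rw [Finset.sum_comm]
        refine Finset.sum_congr rfl fun p hp => ?_
        have hn := add_eq_of_mem_antidiagonal hp
        -- The merges at `l ≤ p.1` come from the left factor (`e2`), the later ones from the right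
        -- factor (`e3`).
        rw [show n + 1 = p.1 + 1 + p.2 by omega, Finset.sum_range_add _ (p.1 + 1) p.2]
      · rw [actSum_succ, Finset.smul_sum]

/-- The algebra acting on itself, with the last label as the end: the term in which the end absorbs
its neighbour becomes the merge at `n`. The strong induction supplies the hypothesis of
`d_actSum_aux`. -/
theorem IsTwisted.d_assocSum (hA : IsTwisted mulA dA dA GA GA lab lab cA) (n : ℕ) (t : ℕ → T) :
    dA (assocSum mulA (n + 1) (lab ∘ t)) =
      ∑ l ∈ Finset.range (n + 1), (-1 : k) ^ l • assocSum mulA n (lab ∘ mergeAt cA l t) := by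
  induction n using Nat.strong_induction_on generalizing t with
  | _ n ih =>
    rw [assocSum_eq_actSum]
    refine (hA.d_actSum_aux hA n ih t (t (n + 1))).trans ?_
    rw [Finset.sum_range_succ]
    congr 1
    · refine Finset.sum_congr rfl fun l hl => ?_
      rw [assocSum_eq_actSum, Function.comp_apply,
        mergeAt_of_gt _ _ (Finset.mem_range.1 hl)]
    · rw [assocSum_eq_actSum, Function.comp_apply, mergeAt_self]
      congr 1
      refine sub_eq_zero.1 ((Submodule.mem_bot k).1 (actSum_sub_mem mulA mulA (NA := ⊥) (N := ⊥)
        (by simp) (by simp) (by simp) (by simp) n _ _ _ _ (fun m hm => ?_) (by simp)))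
      simp [mergeAt_of_lt _ _ hm]

/-- The differential of `actSum` merges neighbouring labels. -/
theorem IsTwisted.d_actSum (hA : IsTwisted mulA dA dA GA GA lab lab cA)
    (h : IsTwisted mul dA dM GA GM lab inc c) (n : ℕ) (t : ℕ → T) (e : End) :
    dM (actSum mulA mul (n + 1) (lab ∘ t) (inc e)) =
      ∑ l ∈ Finset.range n, (-1 : k) ^ l • actSum mulA mul n (lab ∘ mergeAt cA l t) (inc e) +
        (-1 : k) ^ n • actSum mulA mul n (lab ∘ t) (inc (c (t n) e)) :=
  hA.d_actSum_aux h n (fun i _ t => hA.d_assocSum i t) t e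

end Comb

/-! ### The bar complex of words and its contraction. -/

/-- A word of positive blocks followed by a last block, recorded as the numbers of multiplications
in each block. -/
abbrev Word := List ℕ × ℕ

namespace Word

/-- Put a block in front of a word. -/
def cons (x : ℕ) (w : Word) : Word := (x :: w.1, w.2)

/-- Merge the blocks number `i` and `i + 1`. -/
def merge : ℕ → List ℕ → ℕ → Word
  | _, [], j => ([], j)
  | 0, [x], j => ([], x + j + 1)
  | 0, x :: y :: l, j => ((x + y + 1) :: l, j)
  | i + 1, x :: l, j => cons x (merge i l j)

theorem merge_zero_ne (l : List ℕ) (x j : ℕ) : merge 0 (x :: l) j ≠ ([], 0) := by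
  cases l <;> simp [merge]

/-- If no block remains, the merge has put at least its own multiplication into the last block. -/
theorem merge_ne (i : ℕ) (l : List ℕ) (x j : ℕ) : merge i (x :: l) j ≠ ([], 0) := by
  cases i with
  | zero => exact merge_zero_ne l x j
  | succ i => simp [merge, cons]

/-- Translates an interior merge into `mergeAt`, the form produced by the differential. Beyond the
end of the list both sides take the default value `0`. -/
theorem merge_lt {i : ℕ} {l : List ℕ} (j : ℕ) (hi : i + 1 < l.length) :
    (merge i l j).1.length + 1 = l.length ∧ (merge i l j).2 = j ∧
      ∀ m, (merge i l j).1.getD m 0 =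
        mergeAt (fun x y => x + y + 1) i (fun m => l.getD m 0) m := by
  induction i generalizing l with
  | zero =>
    rcases l with _ | ⟨x, _ | ⟨y, l⟩⟩
    · simp at hi
    · simp at hi
    · refine ⟨by simp [merge], rfl, fun m => ?_⟩
      cases m <;> simp [merge, mergeAt]
  | succ i ih =>
    rcases l with _ | ⟨x, l⟩
    · simp at hi
    · obtain ⟨h1, h2, h3⟩ := ih (l := l) (by simpa using hi)
      refine ⟨by simpa [merge, cons] using h1, by simpa [merge, cons] using h2, fun m => ?_⟩
      cases m with
      | zero => simp [merge, mergeAt, cons]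
      | succ m =>
        simp only [merge, cons, List.getD_cons_succ, h3]
        simp [mergeAt]

/-- The other case: the final positive block is absorbed by the last block. -/
theorem merge_last (l : List ℕ) (i j : ℕ) (hi : i + 1 = l.length) :
    (merge i l j).1.length = i ∧ (merge i l j).2 = l.getD i 0 + j + 1 ∧
      ∀ m < i, (merge i l j).1.getD m 0 = l.getD m 0 := by
  induction i generalizing l with
  | zero =>
    rcases l with _ | ⟨x, _ | ⟨y, l⟩⟩
    · simp at hi
    · simp [merge]
    · simp at hi
  | succ i ih =>
    rcases l with _ | ⟨x, l⟩
    · simp at hi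
    · obtain ⟨h1, h2, h3⟩ := ih l (by simpa using hi)
      refine ⟨by simpa [merge, cons] using h1, by simpa [merge, cons] using h2, fun m hm => ?_⟩
      cases m with
      | zero => simp [merge, cons]
      | succ m => simpa [merge, cons] using h3 m (by omega)

variable (k : Type*) [Field k] (K : Type*)

/-- The differential of the bar complex of words, with a coefficient in `K`. -/
noncomputable def d : (K × Word →₀ k) →ₗ[k] (K × Word →₀ k) :=
  Finsupp.linearCombination k fun p => ∑ i ∈ Finset.range p.2.1.length,
    Finsupp.single (p.1, merge i p.2.1 p.2.2) ((-1 : k) ^ i)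

/-- Split off the first letter of a word. -/
noncomputable def split : K × Word → (K × Word →₀ k)
  | (_, ([], 0)) => 0
  | (κ, ([], j + 1)) => Finsupp.single (κ, ([0], j)) 1
  | (_, (0 :: _, _)) => 0
  | (κ, ((x + 1) :: l, j)) => Finsupp.single (κ, (0 :: x :: l, j)) 1

/-- The contracting homotopy of the bar complex of words. -/
noncomputable def h : (K × Word →₀ k) →ₗ[k] (K × Word →₀ k) :=
  Finsupp.linearCombination k (split k K)

/-- The projection onto the empty words. -/
noncomputable def proj : (K × Word →₀ k) →ₗ[k] (K × Word →₀ k) :=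
  Finsupp.linearCombination k fun p => if p.2 = ([], 0) then Finsupp.single p 1 else 0

variable {k K}

theorem split_cons_zero (κ : K) (w : Word) : split k K (κ, cons 0 w) = 0 := rfl

theorem split_cons_succ (κ : K) (x : ℕ) (w : Word) :
    split k K (κ, cons (x + 1) w) = Finsupp.single (κ, cons 0 (cons x w)) 1 := rfl

theorem split_merge_zero (κ : K) (l : List ℕ) (j : ℕ) :
    split k K (κ, merge 0 (0 :: l) j) = Finsupp.single (κ, (0 :: l, j)) 1 := by
  cases l with
  | nil => simp [merge, split]
  | cons y l => simp [merge, split]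

/-- A first letter with a multiplication to spare keeps it under every merge, so splitting after the
merge only puts a `0` in front of a merge of the shortened word. -/
theorem split_merge_succ (κ : K) (i x : ℕ) (l : List ℕ) (j : ℕ) :
    split k K (κ, merge i ((x + 1) :: l) j) =
      Finsupp.single (κ, cons 0 (merge i (x :: l) j)) 1 := by
  cases i with
  | succ i => simp only [merge, split_cons_succ]
  | zero =>
    cases l with
    | nil => simp [merge, split, cons, add_right_comm]
    | cons y l => simp [merge, split, cons, add_right_comm]

/-- The homotopy replaces a first letter `x^(m+1)`, `m ≥ 1`, by `x ⊗ x^m`; a word with no positive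
block has its last block split instead. If the first letter is already `x`, `h` kills the word and
all its merges but the one at `0`, from which it restores the word. Otherwise the merge at `0` in `d
h` returns the word, and the remaining merges, moved by one index, cancel `h d`. -/
theorem d_h_add_h_d : d k K ∘ₗ h k K + h k K ∘ₗ d k K + proj k K = LinearMap.id := by
  refine Finsupp.lhom_ext' fun p => LinearMap.ext_ring ?_
  obtain ⟨κ, l, j⟩ := p
  simp only [LinearMap.comp_apply, LinearMap.add_apply, Finsupp.lsingle_apply, LinearMap.id_apply,
    h, d, proj, Finsupp.linearCombination_single, one_smul, map_sum]
  match l, j with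
  | [], 0 => simp [split]
  | [], j + 1 => simp [split, merge]
  | 0 :: l, j =>
    rw [show split k K (κ, (0 :: l, j)) = 0 from rfl, List.length_cons, Finset.sum_range_succ']
    simp only [merge, split_cons_zero, split_merge_zero]
    simp
  | (x + 1) :: l, j =>
    simp only [split_merge_succ]
    rw [show split k K (κ, ((x + 1) :: l, j)) = Finsupp.single (κ, (0 :: x :: l, j)) 1 from rfl]
    simp only [Finsupp.linearCombination_single, one_smul, List.length_cons]
    rw [Finset.sum_range_succ']
    simp [merge, pow_succ, cons]

/-- Boundaries do not meet the empty words; hence the scalar in front of the unit is unique. -/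
theorem d_apply_nil (b : K × Word →₀ k) (κ : K) : d k K b (κ, ([], 0)) = 0 := by
  induction b using Finsupp.induction_linear with
  | zero => simp
  | add x y hx hy => rw [map_add, Finsupp.add_apply, hx, hy, add_zero]
  | single p a =>
    classical
    obtain ⟨κ', l, j⟩ := p
    rw [d, Finsupp.linearCombination_single, Finsupp.smul_apply, Finsupp.finsetSum_apply,
      Finset.sum_eq_zero, smul_zero]
    intro i hi
    rcases l with _ | ⟨x, l⟩
    · simp at hi
    · rw [Finsupp.single_apply, if_neg]
      intro hh
      exact merge_ne i l x j (Prod.ext_iff.1 hh).2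

/-- The words allowed with coefficient in `K`: the empty word has the coefficient `κ₀`. -/
def valid (κ₀ : K) : Set (K × Word) := {p | p.2 = ([], 0) → p.1 = κ₀}

/-- Validity is a condition on empty words only, and these do not occur in the image of `d`;
therefore `b` itself may be arbitrary. -/
theorem d_mem (κ₀ : K) (b : K × Word →₀ k) : d k K b ∈ Finsupp.supported k k (valid κ₀) := by
  rw [Finsupp.mem_supported']
  rintro ⟨κ, w⟩ hp
  have : w = ([], 0) := by
    by_contra h
    exact hp fun h' => (h h').elim
  rw [this, d_apply_nil]

theorem h_mem (κ₀ : K) (b : K × Word →₀ k) : h k K b ∈ Finsupp.supported k k (valid κ₀) := by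
  induction b using Finsupp.induction_linear with
  | zero => simp
  | add x y hx hy => rw [map_add]; exact Submodule.add_mem _ hx hy
  | single p a =>
    obtain ⟨κ, l, j⟩ := p
    rw [h, Finsupp.linearCombination_single]
    refine Submodule.smul_mem _ _ ?_
    match l, j with
    | [], 0 => exact Submodule.zero_mem _
    | [], j + 1 => exact Finsupp.single_mem_supported _ _ fun hh => by simp at hh
    | 0 :: l, j => exact Submodule.zero_mem _
    | (x + 1) :: l, j => exact Finsupp.single_mem_supported _ _ fun hh => by simp at hh

theorem proj_eq (κ₀ : K) {b : K × Word →₀ k} (hb : b ∈ Finsupp.supported k k (valid κ₀)) :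
    proj k K b = Finsupp.single (κ₀, ([], 0)) (b (κ₀, ([], 0))) := by
  rw [proj, Finsupp.linearCombination_apply, Finsupp.sum]
  rw [Finset.sum_eq_single (κ₀, ([], 0))]
  · simp
  · rintro ⟨κ, w⟩ hp hne
    rw [if_neg, smul_zero]
    rintro rfl
    exact hne (Prod.ext ((Finsupp.mem_supported _ _).1 hb hp rfl) rfl)
  · intro h0
    simp [Finsupp.notMem_support_iff.1 h0]

theorem eqOn_supported {M : Type*} [AddCommGroup M] [Module k M] {V : Set (K × Word)}
    {f g : (K × Word →₀ k) →ₗ[k] M}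
    (hfg : ∀ p ∈ V, f (Finsupp.single p 1) = g (Finsupp.single p 1)) :
    ∀ b ∈ Finsupp.supported k k V, f b = g b := by
  intro b hb
  rw [Finsupp.supported_eq_span_single] at hb
  have := LinearMap.eqOn_span (f := f) (g := g) (s := (fun i => Finsupp.single i 1) '' V)
    (by rintro _ ⟨p, hp, rfl⟩; exact hfg p hp)
  exact this hb

/-- A complex with a basis of words whose differential merges blocks is acyclic. -/
theorem existsUnique_of_basis {M : Type*} [AddCommGroup M] [Module k M] (κ₀ : K) (D : M →ₗ[k] M)
    (N : Submodule k M) (e : M) (Φ : (K × Word →₀ k) →ₗ[k] M) (Ψ : M →ₗ[k] (K × Word →₀ k))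
    (hN : N = Submodule.map Φ (Finsupp.supported k k (valid κ₀)))
    (hΨ : ∀ p ∈ valid κ₀, Ψ (Φ (Finsupp.single p 1)) = Finsupp.single p 1)
    (hD : ∀ p ∈ valid κ₀, D (Φ (Finsupp.single p 1)) = Φ (d k K (Finsupp.single p 1)))
    (he : e = Φ (Finsupp.single (κ₀, ([], 0)) 1)) (z : M) (hz : z ∈ N) (hDz : D z = 0) :
    ∃! a : k, ∃ y ∈ N, z = a • e + D y := by
  have hΨ' : ∀ b ∈ Finsupp.supported k k (valid κ₀), Ψ (Φ b) = b :=
    eqOn_supported (f := Ψ ∘ₗ Φ) (g := LinearMap.id) hΨ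
  have hD' : ∀ b ∈ Finsupp.supported k k (valid κ₀), D (Φ b) = Φ (d k K b) :=
    eqOn_supported (f := D ∘ₗ Φ) (g := Φ ∘ₗ d k K) hD
  subst hN
  obtain ⟨b, hb, rfl⟩ := hz
  -- `Ψ` inverts `Φ` only on valid words, and `d_mem` puts `d b` among them.
  have hdb : d k K b = 0 := by
    rw [← hΨ' _ (d_mem κ₀ b), ← hD' b hb, hDz, map_zero]
  have hbd : b = b (κ₀, ([], 0)) • Finsupp.single (κ₀, ([], 0)) 1 + d k K (h k K b) := by
    have := LinearMap.congr_fun (d_h_add_h_d (k := k) (K := K)) b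
    simp only [LinearMap.add_apply, LinearMap.comp_apply, hdb, map_zero, add_zero,
      LinearMap.id_apply, proj_eq κ₀ hb] at this
    rw [Finsupp.smul_single, smul_eq_mul, mul_one, add_comm]
    exact this.symm
  refine ⟨b (κ₀, ([], 0)), ⟨Φ (h k K b), ⟨_, h_mem κ₀ b, rfl⟩, ?_⟩, ?_⟩
  · rw [hD' _ (h_mem κ₀ b), he, ← map_smul, ← map_add, ← hbd]
  · rintro a ⟨_, ⟨c, hc, rfl⟩, hac⟩
    -- The equation is transported back to words, where the coefficient of the empty word reads off
    -- `a`.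
    have h1 : b = a • Finsupp.single (κ₀, ([], 0)) 1 + d k K c := by
      have h0 : Finsupp.single (κ₀, ([], 0)) (1 : k) ∈ Finsupp.supported k k (valid κ₀) :=
        Finsupp.single_mem_supported _ _ fun _ => rfl
      rw [← hΨ' b hb, hac, he, hD' c hc, map_add, map_smul, hΨ' _ h0, hΨ' _ (d_mem κ₀ c)]
    rw [h1]
    simp [d_apply_nil]

end Word

/-! ### Planar trees on `μ`, `ρ` and `f`. -/

namespace HSC₁

open Colour

variable {X Y : Colour → Type}

/-- The tree `μ(a, b)`. -/
def muT (a b : Tree Gen X cl) : Tree Gen X cl :=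
  .node .mu fun
    | ⟨0, _⟩ => a
    | ⟨1, _⟩ => b

/-- The tree `ρ(a, v)`. -/
def rhoT (a : Tree Gen X cl) (v : Tree Gen X op) : Tree Gen X op :=
  .node .rho fun
    | ⟨0, _⟩ => a
    | ⟨1, _⟩ => v

/-- The tree `f(a)`. -/
def fT (a : Tree Gen X cl) : Tree Gen X op :=
  .node .f fun
    | ⟨0, _⟩ => a

theorem node_mu (t : (i : Fin [cl, cl].length) → Tree Gen X ([cl, cl].get i)) :
    Tree.node Gen.mu t = muT (t ⟨0, by simp⟩) (t ⟨1, by simp⟩) := by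
  unfold muT
  congr 1
  funext i
  match i with
  | ⟨0, _⟩ => rfl
  | ⟨1, _⟩ => rfl

theorem node_rho (t : (i : Fin [cl, op].length) → Tree Gen X ([cl, op].get i)) :
    Tree.node Gen.rho t = rhoT (t ⟨0, by simp⟩) (t ⟨1, by simp⟩) := by
  unfold rhoT
  congr 1
  funext i
  match i with
  | ⟨0, _⟩ => rfl
  | ⟨1, _⟩ => rfl

theorem node_f (t : (i : Fin [cl].length) → Tree Gen X ([cl].get i)) :
    Tree.node Gen.f t = fT (t ⟨0, by simp⟩) := by
  unfold fT
  congr 1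
  funext i
  match i with
  | ⟨0, _⟩ => rfl

theorem mu_eq (a b : PTree Gen cl) : mu a b = muT a b := node_mu _
theorem rho_eq (a : PTree Gen cl) (v : PTree Gen op) : rho a v = rhoT a v := node_rho _
theorem f_eq (a : PTree Gen cl) : f a = fT a := node_f _

/-- Simultaneous induction over both colours, in terms of `muT`, `rhoT`, `fT` instead of families of
children indexed by `Fin`. -/
theorem tree_induction {p : Tree Gen X cl → Prop} {q : Tree Gen X op → Prop}
    (leaf_cl : ∀ x, p (.leaf x)) (mul : ∀ a b, p a → p b → p (muT a b))
    (leaf_op : ∀ x, q (.leaf x)) (act : ∀ a v, p a → q v → q (rhoT a v))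
    (pt : ∀ a, p a → q (fT a)) : (∀ t, p t) ∧ ∀ t, q t := by
  have key : ∀ (s : Colour) (t : Tree Gen X s),
      (match s with | cl => p | op => q : Tree Gen X s → Prop) t := by
    intro s t
    induction t with
    | @leaf s x => cases s with
      | cl => exact leaf_cl x
      | op => exact leaf_op x
    | node g t ih =>
      cases g with
      | mu => rw [node_mu]; exact mul _ _ (ih ⟨0, by simp⟩) (ih ⟨1, by simp⟩)
      | rho => rw [node_rho]; exact act _ _ (ih ⟨0, by simp⟩) (ih ⟨1, by simp⟩)
      | f => rw [node_f]; exact pt _ (ih ⟨0, by simp⟩)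
  exact ⟨key cl, key op⟩

theorem cl_induction {p : Tree Gen X cl → Prop} (leaf : ∀ x, p (.leaf x))
    (mul : ∀ a b, p a → p b → p (muT a b)) (t : Tree Gen X cl) : p t :=
  (tree_induction (q := fun _ => True) leaf mul (fun _ => trivial) (fun _ _ _ _ => trivial)
    fun _ _ => trivial).1 t

theorem op_induction {q : Tree Gen X op → Prop} (leaf : ∀ x, q (.leaf x))
    (act : ∀ a v, q v → q (rhoT a v)) (pt : ∀ a, q (fT a)) (t : Tree Gen X op) : q t :=
  (tree_induction (p := fun _ => True) (fun _ => trivial) (fun _ _ _ _ => trivial) leaf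
    (fun a v _ => act a v) fun a _ => pt a).2 t

/-! ### The structure maps of trees -/

@[simp] theorem weight_leaf {s : Colour} (x : X s) : (Tree.leaf x : Tree Gen X s).weight = 0 := rfl

@[simp] theorem weight_muT (a b : Tree Gen X cl) : (muT a b).weight = a.weight + b.weight + 1 := by
  simp only [muT, Tree.weight]
  rw [add_comm]; congr 1

@[simp] theorem weight_rhoT (a : Tree Gen X cl) (v : Tree Gen X op) :
    (rhoT a v).weight = a.weight + v.weight + 1 := by
  simp only [rhoT, Tree.weight]
  rw [add_comm]; congr 1

@[simp] theorem weight_fT (a : Tree Gen X cl) : (fT a).weight = a.weight + 1 := by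
  simp only [fT, Tree.weight]
  rw [add_comm]; congr 1

@[simp] theorem leaves_leaf {s : Colour} (x : X s) :
    (Tree.leaf x : Tree Gen X s).leaves = [s] := rfl

@[simp] theorem leaves_muT (a b : Tree Gen X cl) : (muT a b).leaves = a.leaves ++ b.leaves := by
  simp [muT, Tree.leaves, List.ofFn_succ]

@[simp] theorem leaves_rhoT (a : Tree Gen X cl) (v : Tree Gen X op) :
    (rhoT a v).leaves = a.leaves ++ v.leaves := by
  simp [rhoT, Tree.leaves, List.ofFn_succ]

@[simp] theorem leaves_fT (a : Tree Gen X cl) : (fT a).leaves = a.leaves := by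
  simp [fT, Tree.leaves, List.ofFn_succ]

/-- The sums to be computed range over `Fin I.length` and agree with these literal forms only after
unfolding, whence the uses of `erw`. -/
theorem Iio_zero : (Finset.Iio (⟨0, Nat.zero_lt_succ 1⟩ : Fin 2)) = ∅ := by decide
theorem Iio_one : (Finset.Iio (⟨1, Nat.one_lt_succ_succ 0⟩ : Fin 2)) =
    {⟨0, Nat.zero_lt_succ 1⟩} := by decide
theorem Iio_zero' : (Finset.Iio (⟨0, Nat.zero_lt_succ 0⟩ : Fin 1)) = ∅ := by decide

@[simp] theorem subst_leaf {s : Colour} (y : Y s) (u : ℕ → (c : Colour) → Tree Gen X c) :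
    (Tree.leaf y : Tree Gen Y s).subst u = u 0 s := rfl

@[simp] theorem subst_muT (a b : Tree Gen Y cl) (u : ℕ → (c : Colour) → Tree Gen X c) :
    (muT a b).subst u = muT (a.subst u) (b.subst fun m => u (a.leaves.length + m)) := by
  conv_lhs => simp only [muT, Tree.subst]
  rw [node_mu]
  all_goals congr 2
  all_goals funext m
  · exact congrArg u (by unfold Tree.offset; erw [Iio_zero]; simp)

@[simp] theorem subst_rhoT (a : Tree Gen Y cl) (v : Tree Gen Y op)
    (u : ℕ → (c : Colour) → Tree Gen X c) :
    (rhoT a v).subst u = rhoT (a.subst u) (v.subst fun m => u (a.leaves.length + m)) := by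
  conv_lhs => simp only [rhoT, Tree.subst]
  rw [node_rho]
  all_goals congr 2
  all_goals funext m
  · exact congrArg u (by unfold Tree.offset; erw [Iio_zero]; simp)

@[simp] theorem subst_fT (a : Tree Gen Y cl) (u : ℕ → (c : Colour) → Tree Gen X c) :
    (fT a).subst u = fT (a.subst u) := by
  conv_lhs => simp only [fT, Tree.subst]
  rw [node_f]
  congr 2
  funext m
  exact congrArg u (by unfold Tree.offset; erw [Iio_zero']; simp)

@[simp] theorem join_leaf {s : Colour} (x : PTree Gen s) :
    (Tree.leaf x : Tree Gen (PTree Gen) s).join = x := rfl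

@[simp] theorem labelWeight_leaf {s : Colour} (y : Y s) (u : ℕ → (c : Colour) → Tree Gen X c) :
    (Tree.leaf y : Tree Gen Y s).labelWeight u = (u 0 s).weight := rfl

@[simp] theorem crossings_leaf {s : Colour} (y : Y s) (u : ℕ → (c : Colour) → Tree Gen X c) :
    (Tree.leaf y : Tree Gen Y s).crossings u = 0 := rfl

@[simp] theorem crossings_muT (a b : Tree Gen Y cl) (u : ℕ → (c : Colour) → Tree Gen X c) :
    (muT a b).crossings u = a.crossings u +
      ((b.crossings fun m => u (a.leaves.length + m)) + b.weight * a.labelWeight u) := by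
  conv_lhs => simp only [muT, Tree.crossings]
  refine (Fin.sum_univ_two _).trans ?_
  congr 1
  · change Tree.crossings a _ + a.weight * _ = _
    erw [Iio_zero]
    unfold Tree.offset
    erw [Iio_zero]
    simp
  · change Tree.crossings b _ + b.weight * _ = _
    erw [Iio_one]
    unfold Tree.offset
    erw [Iio_one]
    simp only [Finset.sum_singleton]
    erw [Iio_zero]
    simp

@[simp] theorem crossings_rhoT (a : Tree Gen Y cl) (v : Tree Gen Y op)
    (u : ℕ → (c : Colour) → Tree Gen X c) :
    (rhoT a v).crossings u = a.crossings u +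
      ((v.crossings fun m => u (a.leaves.length + m)) + v.weight * a.labelWeight u) := by
  conv_lhs => simp only [rhoT, Tree.crossings]
  refine (Fin.sum_univ_two _).trans ?_
  congr 1
  · change Tree.crossings a _ + a.weight * _ = _
    erw [Iio_zero]
    unfold Tree.offset
    erw [Iio_zero]
    simp
  · change Tree.crossings v _ + v.weight * _ = _
    erw [Iio_one]
    unfold Tree.offset
    erw [Iio_one]
    simp only [Finset.sum_singleton]
    erw [Iio_zero]
    simp

@[simp] theorem crossings_fT (a : Tree Gen Y cl) (u : ℕ → (c : Colour) → Tree Gen X c) :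
    (fT a).crossings u = a.crossings u := by
  conv_lhs => simp only [fT, Tree.crossings]
  refine (Fin.sum_univ_one _).trans ?_
  change Tree.crossings a _ + a.weight * _ = _
  erw [Iio_zero']
  unfold Tree.offset
  erw [Iio_zero']
  simp

variable {X : Colour → Type}

/-! ### Kinds and signs of trees -/

/-- Whether the rightmost path from the root avoids `f`: whether the last input is open. -/
def lastOpen : {s : Colour} → Tree Gen X s → Bool
  | _, .leaf _ => true
  | _, .node .mu _ => true
  | _, .node .rho t => lastOpen (t ⟨1, by simp⟩)
  | _, .node .f _ => false

@[simp] theorem lastOpen_leaf {s : Colour} (x : X s) :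
    lastOpen (Tree.leaf x : Tree Gen X s) = true := by rw [lastOpen]

@[simp] theorem lastOpen_rhoT (a : Tree Gen X cl) (v : Tree Gen X op) :
    lastOpen (rhoT a v) = lastOpen v := by rw [rhoT, lastOpen]

@[simp] theorem lastOpen_fT (a : Tree Gen X cl) : lastOpen (fT a) = false := by rw [fT, lastOpen]

/-- With this convention the kind is no condition in the closed colour, and statements about
profiles cover both colours. -/
theorem lastOpen_cl (t : Tree Gen X cl) : lastOpen t = true := by
  induction t using cl_induction with
  | leaf x => simp
  | mul a b => rw [muT, lastOpen]

/-- The sign of a tree in the generators of the Koszul dual cooperad. -/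
def sgn (k : Type*) [Field k] : {s : Colour} → Tree Gen X s → k
  | _, .leaf _ => 1
  | _, .node _ t => ∏ i, ((if i.val = 0 then (-1) ^ (t i).weight else 1) * sgn k (t i))

section

variable {k : Type*} [Field k]

@[simp] theorem sgn_leaf {s : Colour} (x : X s) : sgn k (Tree.leaf x : Tree Gen X s) = 1 := by
  rw [sgn]

@[simp] theorem sgn_muT (a b : Tree Gen X cl) :
    sgn k (muT a b) = (-1) ^ a.weight * (sgn k a * sgn k b) := by
  rw [muT, sgn]
  refine (Fin.prod_univ_two _).trans ?_
  simp [mul_assoc]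

@[simp] theorem sgn_rhoT (a : Tree Gen X cl) (v : Tree Gen X op) :
    sgn k (rhoT a v) = (-1) ^ a.weight * (sgn k a * sgn k v) := by
  rw [rhoT, sgn]
  refine (Fin.prod_univ_two _).trans ?_
  simp [mul_assoc]

@[simp] theorem sgn_fT (a : Tree Gen X cl) : sgn k (fT a) = (-1) ^ a.weight * sgn k a := by
  rw [fT, sgn]
  refine (Fin.prod_univ_one _).trans ?_
  simp

theorem sgn_mul_self {s : Colour} (t : Tree Gen X s) : sgn k t * sgn k t = 1 := by
  have h : ∀ n : ℕ, (-1 : k) ^ n * (-1) ^ n = 1 := fun n => by rw [← mul_pow]; simp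
  have key : (∀ t : Tree Gen X cl, sgn k t * sgn k t = 1) ∧
      ∀ t : Tree Gen X op, sgn k t * sgn k t = 1 := by
    refine tree_induction (by simp) (fun a b ha hb => ?_) (by simp) (fun a b ha hb => ?_)
      (fun a ha => ?_)
    · rw [sgn_muT, mul_mul_mul_comm, mul_mul_mul_comm (sgn k a), h, ha, hb, one_mul, one_mul]
    · rw [sgn_rhoT, mul_mul_mul_comm, mul_mul_mul_comm (sgn k a), h, ha, hb, one_mul, one_mul]
    · rw [sgn_fT, mul_mul_mul_comm, h, ha, one_mul]
  cases s with
  | cl => exact key.1 t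
  | op => exact key.2 t

end

theorem leaves_cl (t : Tree Gen X cl) : t.leaves = List.replicate (t.weight + 1) cl := by
  induction t using cl_induction with
  | leaf x => simp
  | mul a b ha hb =>
    rw [leaves_muT, ha, hb, List.replicate_append_replicate, weight_muT]
    congr 1
    omega

/-- The rightmost path runs through vertices `ρ` and stops at an open leaf or at an `f`, above which
everything is closed. Each `ρ` and `μ` adds one input, while an `f` only turns the open last input
into a closed one. -/
theorem leaves_op (t : Tree Gen X op) :
    t.leaves = List.replicate t.weight cl ++ if lastOpen t then [op] else [] := by
  induction t using op_induction with
  | leaf x => simp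
  | act a v hv =>
    rw [leaves_rhoT, hv, leaves_cl, ← List.append_assoc, List.replicate_append_replicate,
      weight_rhoT, lastOpen_rhoT]
    congr 2
    omega
  | pt a => simp [leaves_cl]

theorem length_leaves_cl (t : Tree Gen X cl) : t.leaves.length = t.weight + 1 := by
  simp [leaves_cl]

/-- The sequence of leaves determines the weight and the kind of a tree. -/
theorem weight_eq_and_lastOpen_eq {s : Colour} {t t' : Tree Gen X s} (h : t.leaves = t'.leaves) :
    t.weight = t'.weight ∧ lastOpen t = lastOpen t' := by
  cases s with
  | cl =>
    rw [leaves_cl, leaves_cl] at h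
    exact ⟨by simpa using congrArg List.length h, by rw [lastOpen_cl, lastOpen_cl]⟩
  | op =>
    rw [leaves_op, leaves_op] at h
    have h1 : lastOpen t = lastOpen t' := by
      have h2 : op ∈ (List.replicate t.weight cl ++ if lastOpen t then [op] else []) ↔
          op ∈ (List.replicate t'.weight cl ++ if lastOpen t' then [op] else []) := by rw [h]
      revert h2
      cases lastOpen t <;> cases lastOpen t' <;> simp
    refine ⟨?_, h1⟩
    rw [h1] at h
    simpa using congrArg List.length h

theorem leaves_eq {s : Colour} {t t' : Tree Gen X s} (h : t.weight = t'.weight)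
    (h' : lastOpen t = lastOpen t') : t.leaves = t'.leaves := by
  cases s with
  | cl => rw [leaves_cl, leaves_cl, h]
  | op => rw [leaves_op, leaves_op, h, h']

/-! ### Rotations -/

/-- A relation stable under grafting is stable under filling the hole of a context. -/
theorem plug_rel {R : {s : Colour} → Tree Gen X s → Tree Gen X s → Prop}
    (mul_left : ∀ {a a' : Tree Gen X cl} (b : Tree Gen X cl), R a a' → R (muT a b) (muT a' b))
    (mul_right : ∀ (a : Tree Gen X cl) {b b' : Tree Gen X cl}, R b b' → R (muT a b) (muT a b'))
    (act_left : ∀ {a a' : Tree Gen X cl} (v : Tree Gen X op), R a a' → R (rhoT a v) (rhoT a' v))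
    (act_right : ∀ (a : Tree Gen X cl) {v v' : Tree Gen X op}, R v v' → R (rhoT a v) (rhoT a v'))
    (pt : ∀ {a a' : Tree Gen X cl}, R a a' → R (fT a) (fT a'))
    {c s : Colour} (C : Context Gen X c s) {w w' : Tree Gen X c} (h : R w w') :
    R (C.plug w) (C.plug w') := by
  induction C with
  | hole => exact h
  | node g i t C ih =>
    simp only [Context.plug]
    cases g with
    | mu =>
      rw [node_mu, node_mu]
      match i with
      | ⟨0, _⟩ => exact mul_left _ ih
      | ⟨1, _⟩ => exact mul_right _ ih
    | rho =>
      rw [node_rho, node_rho]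
      match i with
      | ⟨0, _⟩ => exact act_left _ ih
      | ⟨1, _⟩ => exact act_right _ ih
    | f =>
      rw [node_f, node_f]
      match i with
      | ⟨0, _⟩ => exact pt ih

/-- The pairs of trees whose difference is a defining relation. -/
inductive Basic : List Colour → (c : Colour) → PTree Gen c → PTree Gen c → Prop
  | mu : Basic [cl, cl, cl] cl (muT (muT (one cl) (one cl)) (one cl))
      (muT (one cl) (muT (one cl) (one cl)))
  | rho : Basic [cl, cl, op] op (rhoT (muT (one cl) (one cl)) (one op))
      (rhoT (one cl) (rhoT (one cl) (one op)))
  | f : Basic [cl, cl] op (fT (muT (one cl) (one cl))) (rhoT (one cl) (fT (one cl)))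

theorem Basic.relations {J : List Colour} {c : Colour} {t₁ t₂ : PTree Gen c}
    (h : Basic J c t₁ t₂) (k : Type*) [Field k] :
    relations k J c = {Finsupp.single t₁ 1 - Finsupp.single t₂ 1} := by
  cases h with
  | mu => simp only [HSC₁.relations, mu_eq]
  | rho => simp only [HSC₁.relations, mu_eq, rho_eq]
  | f => simp only [HSC₁.relations, mu_eq, rho_eq, f_eq]

theorem mem_relations {k : Type*} [Field k] {J : List Colour} {c : Colour} {r : PTree Gen c →₀ k}
    (h : r ∈ relations k J c) :
    ∃ t₁ t₂, Basic J c t₁ t₂ ∧ r = Finsupp.single t₁ 1 - Finsupp.single t₂ 1 := by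
  have h' := h
  unfold HSC₁.relations at h'
  split at h'
  · exact ⟨_, _, .mu, by simpa [Basic.mu.relations] using h⟩
  · exact ⟨_, _, .rho, by simpa [Basic.rho.relations] using h⟩
  · exact ⟨_, _, .f, by simpa [Basic.f.relations] using h⟩
  · exact h'.elim

/-- The equivalence relation generated by the relations. -/
inductive Rot : {s : Colour} → PTree Gen s → PTree Gen s → Prop
  | refl {s : Colour} (t : PTree Gen s) : Rot t t
  | symm {s : Colour} {t t' : PTree Gen s} : Rot t t' → Rot t' t
  | trans {s : Colour} {t t' t'' : PTree Gen s} : Rot t t' → Rot t' t'' → Rot t t''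
  | basic {J : List Colour} {c s : Colour} {t₁ t₂ : PTree Gen c} (h : Basic J c t₁ t₂)
      (C : Context Gen (fun _ => PUnit) c s) (u : ℕ → (c : Colour) → PTree Gen c) :
      Rot (C.plug (t₁.subst u)) (C.plug (t₂.subst u))

/-- The equation `hc` leaves the colour index of `Rot` free for the induction; in the basic case the
context gains one vertex at its root. -/
theorem Rot.node_cast {I : List Colour} {s : Colour} (g : Gen I s)
    (f : (i : Fin I.length) → PTree Gen (I.get i)) (i : Fin I.length) {c : Colour}
    (hc : c = I.get i) {t t' : PTree Gen c} (h : Rot t t') :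
    Rot (Tree.node g (Function.update f i (hc ▸ t)))
      (Tree.node g (Function.update f i (hc ▸ t'))) := by
  induction h with
  | refl t => exact .refl _
  | symm _ ih => exact (ih hc).symm
  | trans _ _ ih ih' => exact (ih hc).trans (ih' hc)
  | basic h C u =>
    subst hc
    exact Rot.basic h (.node g i f C) u

theorem Rot.mu_left {a a' : PTree Gen cl} (b : PTree Gen cl) (h : Rot a a') :
    Rot (muT a b) (muT a' b) := by
  have := Rot.node_cast Gen.mu (fun | ⟨0, _⟩ => a | ⟨1, _⟩ => b) ⟨0, by simp⟩ rfl h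
  rwa [node_mu, node_mu] at this

theorem Rot.mu_right (a : PTree Gen cl) {b b' : PTree Gen cl} (h : Rot b b') :
    Rot (muT a b) (muT a b') := by
  have := Rot.node_cast Gen.mu (fun | ⟨0, _⟩ => a | ⟨1, _⟩ => b) ⟨1, by simp⟩ rfl h
  rwa [node_mu, node_mu] at this

theorem Rot.rho_left {a a' : PTree Gen cl} (v : PTree Gen op) (h : Rot a a') :
    Rot (rhoT a v) (rhoT a' v) := by
  have := Rot.node_cast Gen.rho (fun | ⟨0, _⟩ => a | ⟨1, _⟩ => v) ⟨0, by simp⟩ rfl h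
  rwa [node_rho, node_rho] at this

theorem Rot.rho_right (a : PTree Gen cl) {v v' : PTree Gen op} (h : Rot v v') :
    Rot (rhoT a v) (rhoT a v') := by
  have := Rot.node_cast Gen.rho (fun | ⟨0, _⟩ => a | ⟨1, _⟩ => v) ⟨1, by simp⟩ rfl h
  rwa [node_rho, node_rho] at this

theorem Rot.f {a a' : PTree Gen cl} (h : Rot a a') : Rot (fT a) (fT a') := by
  have := Rot.node_cast Gen.f (fun | ⟨0, _⟩ => a) ⟨0, by simp⟩ rfl h
  rwa [node_f, node_f] at this

/-- Labels for the substitution of up to three trees in a relation. -/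
def labels (a b c : PTree Gen cl) (v : PTree Gen op) : ℕ → (c : Colour) → PTree Gen c
  | 0, cl => a
  | 1, cl => b
  | _, cl => c
  | _, op => v

/-- This and the next two are the basic pairs with trees grafted on their inputs, in the trivial
context. The values of `labels` at positions that the relation lacks are arbitrary. -/
theorem Rot.mu_assoc (a b c : PTree Gen cl) : Rot (muT (muT a b) c) (muT a (muT b c)) := by
  simpa [one, labels, Context.plug] using Rot.basic .mu .hole (labels a b c (one op))

theorem Rot.rho_assoc (a b : PTree Gen cl) (v : PTree Gen op) :
    Rot (rhoT (muT a b) v) (rhoT a (rhoT b v)) := by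
  simpa [one, labels, Context.plug] using Rot.basic .rho .hole (labels a b a v)

theorem Rot.f_mu (a b : PTree Gen cl) : Rot (fT (muT a b)) (rhoT a (fT b)) := by
  simpa [one, labels, Context.plug] using Rot.basic .f .hole (labels a b a (one op))

/-- The right comb with given weight. -/
def comb : ℕ → PTree Gen cl
  | 0 => one cl
  | n + 1 => muT (one cl) (comb n)

/-- Associativity moves the letters of the first comb out one at a time. The extra `1` is the vertex
joining the two combs. -/
theorem comb_mul (m n : ℕ) : Rot (muT (comb m) (comb n)) (comb (m + n + 1)) := by
  induction m with
  | zero => rw [zero_add]; exact .refl _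
  | succ m ih =>
    rw [show m + 1 + n + 1 = (m + n + 1) + 1 by omega]
    exact (Rot.mu_assoc _ _ _).trans (Rot.mu_right _ ih)

theorem rot_comb (t : PTree Gen cl) : Rot t (comb t.weight) := by
  induction t using cl_induction with
  | leaf x => exact .refl _
  | mul a b ha hb =>
    rw [weight_muT]
    exact ((ha.mu_left b).trans (hb.mu_right _)).trans (comb_mul _ _)

/-- The operations with open output, and one more element `none` thought of as a marked point of
which `f a` is the translate by `a`. -/
abbrev End : Type := Option (PTree Gen op)

/-- The action of operations with closed output on operations with open output. -/
def act (a : PTree Gen cl) : End → End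
  | none => some (fT a)
  | some v => some (rhoT a v)

namespace End

/-- The weight of an end. -/
def weight : End → ℕ
  | none => 0
  | some v => v.weight

/-- Whether an end has an open last input. -/
def lastOpen : End → Bool
  | none => false
  | some v => HSC₁.lastOpen v

/-- The right comb of given kind and weight. -/
def comb (κ : Bool) : ℕ → End
  | 0 => if κ then some (one op) else none
  | n + 1 => act (one cl) (comb κ n)

end End

theorem act_rel_left {a a' : PTree Gen cl} (h : Rot a a') (e : End) :
    Option.Rel Rot (act a e) (act a' e) := by
  cases e with
  | none => exact .some h.f
  | some v => exact .some (h.rho_left v)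

theorem act_rel_right (a : PTree Gen cl) {e e' : End} (h : Option.Rel Rot e e') :
    Option.Rel Rot (act a e) (act a e') := by
  cases h with
  | none => exact .some (.refl _)
  | some h => exact .some (h.rho_right a)

/-- The purpose of the marked point: at `none` this is the relation between `f` and `μ`, at a tree
the one between `ρ` and `μ`. -/
theorem act_mul (a b : PTree Gen cl) (e : End) :
    Option.Rel Rot (act (muT a b) e) (act a (act b e)) := by
  cases e with
  | none => exact .some (.f_mu a b)
  | some v => exact .some (.rho_assoc a b v)

theorem rel_refl (e : End) : Option.Rel Rot e e := by
  cases e with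
  | none => exact .none
  | some v => exact .some (.refl v)

theorem rel_trans {e e' e'' : End} (h : Option.Rel Rot e e') (h' : Option.Rel Rot e' e'') :
    Option.Rel Rot e e'' := by
  cases h with
  | none => exact h'
  | some h => cases h' with | some h' => exact .some (h.trans h')

theorem act_comb (κ : Bool) (m n : ℕ) :
    Option.Rel Rot (act (comb m) (End.comb κ n)) (End.comb κ (m + n + 1)) := by
  induction m with
  | zero => rw [zero_add]; exact rel_refl _
  | succ m ih =>
    rw [show m + 1 + n + 1 = (m + n + 1) + 1 by omega]
    exact rel_trans (act_mul _ _ _) (act_rel_right _ ih)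

/-- A tree `fT a` counts as `a` acting on the empty comb of kind `false`. -/
theorem rel_comb_some (v : PTree Gen op) :
    Option.Rel Rot (some v) (End.comb (lastOpen v) v.weight) := by
  induction v using op_induction with
  | leaf x => exact rel_refl _
  | act a v hv =>
    rw [weight_rhoT, lastOpen_rhoT]
    exact rel_trans (rel_trans (act_rel_left (rot_comb a) (some v)) (act_rel_right _ hv))
      (act_comb _ _ _)
  | pt a =>
    rw [weight_fT, lastOpen_fT]
    exact rel_trans (act_rel_left (rot_comb a) none) (act_comb false a.weight 0)

theorem rel_comb (e : End) : Option.Rel Rot e (End.comb e.lastOpen e.weight) := by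
  cases e with
  | none => exact .none
  | some v => exact rel_comb_some v

/-- The leaves determine weight and kind, and these determine the right comb to which both trees are
equivalent. Thus every component of the operad is at most a line. -/
theorem rot_of_leaves_eq {s : Colour} {t t' : PTree Gen s} (h : t.leaves = t'.leaves) :
    Rot t t' := by
  obtain ⟨hw, hl⟩ := weight_eq_and_lastOpen_eq h
  cases s with
  | cl =>
    have := (rot_comb t').symm
    rw [← hw] at this
    exact (rot_comb t).trans this
  | op =>
    have h1 := rel_comb_some t
    have h2 := rel_comb_some t'
    rw [← hw, ← hl] at h2
    revert h1 h2
    -- A tree is never related to the marked point, so the common comb is a tree.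
    cases End.comb (lastOpen t) t.weight with
    | none => intro h1; cases h1
    | some v =>
      intro h1 h2
      cases h1 with
      | some h1 =>
        cases h2 with
        | some h2 => exact h1.trans h2.symm

/-- Trees of the same profile whose signs differ by the factor `ε`. -/
def SignRel {k : Type*} [Field k] (ε : k) {s : Colour} (t t' : PTree Gen s) : Prop :=
  t.weight = t'.weight ∧ lastOpen t = lastOpen t' ∧ sgn k t = ε * sgn k t'

/-- The sign of a vertex depends on the weight of its first child only. Trees of equal weight in the
hole thus produce the same factors outside it. -/
theorem SignRel.plug {k : Type*} [Field k] {ε : k} {c s : Colour}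
    (C : Context Gen (fun _ => PUnit) c s) {w w' : PTree Gen c} (h : SignRel ε w w') :
    SignRel ε (C.plug w) (C.plug w') := by
  refine plug_rel (R := SignRel ε) ?_ ?_ ?_ ?_ ?_ C h
  · rintro a a' b ⟨h1, h2, h3⟩
    exact ⟨by simp [h1], by simp [lastOpen_cl], by simp [h1, h3]; ring⟩
  · rintro a b b' ⟨h1, h2, h3⟩
    exact ⟨by simp [h1], by simp [lastOpen_cl], by simp [h3]; ring⟩
  · rintro a a' b ⟨h1, h2, h3⟩
    exact ⟨by simp [h1], by simp, by simp [h1, h3]; ring⟩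
  · rintro a b b' ⟨h1, h2, h3⟩
    exact ⟨by simp [h1], by simp [h2], by simp [h3]; ring⟩
  · rintro a a' ⟨h1, h2, h3⟩
    exact ⟨by simp [h1], by simp, by simp [h1, h3]; ring⟩

/-- In the left-leaning tree `t₁` both vertices are visited before any grafted tree. -/
theorem Basic.crossings_eq_zero {J : List Colour} {c : Colour} {t₁ t₂ : PTree Gen c}
    (h : Basic J c t₁ t₂) (u : ℕ → (c : Colour) → PTree Gen c) : t₁.crossings u = 0 := by
  cases h <;> simp [one]

/-- The minus sign is that of the relation in `s²R`. The crossings of `t₂` come from its second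
vertex, which is visited after the tree grafted on the first input. This is why the signs `sgn`
define elements of the Koszul dual. -/
theorem Basic.signRel {J : List Colour} {c : Colour} {t₁ t₂ : PTree Gen c}
    (h : Basic J c t₁ t₂) (k : Type*) [Field k] (u : ℕ → (c : Colour) → PTree Gen c) :
    SignRel (-(-1 : k) ^ t₂.crossings u) (t₁.subst u) (t₂.subst u) := by
  have hs : ∀ n : ℕ, (-1 : k) ^ n * (-1) ^ n = 1 := fun n => by rw [← mul_pow]; simp
  have hs' : ∀ (n : ℕ) (x : k), (-1 : k) ^ n * ((-1) ^ n * x) = x := fun n x => by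
    rw [← mul_assoc, hs, one_mul]
  cases h with
  | mu =>
    refine ⟨by simp [one]; omega, by simp [lastOpen_cl], ?_⟩
    simp [one, pow_add, hs', mul_assoc, mul_left_comm]
  | rho =>
    refine ⟨by simp [one]; omega, by simp [one], ?_⟩
    simp [one, pow_add, hs', mul_assoc, mul_left_comm]
  | f =>
    refine ⟨by simp [one]; omega, by simp [one], ?_⟩
    simp [one, pow_add, hs', mul_assoc, mul_left_comm]

/-- Only weights and kinds are extracted from `signRel`, so the choice of `ℚ` is immaterial. -/
theorem Rot.weight_eq_and_lastOpen_eq {s : Colour} {t t' : PTree Gen s} (h : Rot t t') :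
    t.weight = t'.weight ∧ lastOpen t = lastOpen t' := by
  induction h with
  | refl => exact ⟨rfl, rfl⟩
  | symm _ ih => exact ⟨ih.1.symm, ih.2.symm⟩
  | trans _ _ ih ih' => exact ⟨ih.1.trans ih'.1, ih.2.trans ih'.2⟩
  | basic h C u =>
    have := (h.signRel ℚ u).plug C
    exact ⟨this.1, this.2.1⟩

/-- Without nontrivial grafted trees the two signs are opposite, hence different over `ℚ`. -/
theorem Basic.ne {J : List Colour} {c : Colour} {t₁ t₂ : PTree Gen c} (h : Basic J c t₁ t₂) :
    t₁ ≠ t₂ := by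
  intro h'
  have := (h.signRel ℚ fun _ c => one c).2.2
  have h0 : ∀ t : PTree Gen c, sgn ℚ t ≠ 0 := fun t h => by
    have := sgn_mul_self (k := ℚ) t
    simp [h] at this
  subst h'
  rw [h.crossings_eq_zero] at this
  exact h0 (t₁.subst fun _ c => one c) (by linarith)

theorem Basic.leaves_eq {J : List Colour} {c : Colour} {t₁ t₂ : PTree Gen c} (h : Basic J c t₁ t₂) :
    t₁.leaves = J ∧ t₂.leaves = J ∧ t₁.weight = 2 ∧ t₂.weight = 2 := by
  cases h <;> simp [one]

theorem eq_one_of_weight_eq_zero {s : Colour} {t : PTree Gen s} (h : t.weight = 0) : t = one s := by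
  cases t with
  | leaf x => rfl
  | node g t => simp [Tree.weight] at h

/-- Every tree of weight two occurs in a relation. -/
theorem exists_basic {c : Colour} (t : PTree Gen c) (h : t.weight = 2) :
    ∃ J t₁ t₂, Basic J c t₁ t₂ ∧ (t = t₁ ∨ t = t₂) := by
  have h1 : ∀ a : PTree Gen cl, a.weight = 1 → a = muT (one cl) (one cl) := by
    intro a ha
    induction a using cl_induction with
    | leaf x => simp at ha
    | mul a b =>
      simp only [weight_muT] at ha
      rw [eq_one_of_weight_eq_zero (t := a) (by omega),
        eq_one_of_weight_eq_zero (t := b) (by omega)]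
  cases c with
  | cl =>
    refine ⟨_, _, _, .mu, ?_⟩
    induction t using cl_induction with
    | leaf x => simp at h
    | mul a b =>
      simp only [weight_muT] at h
      rcases Nat.eq_zero_or_pos a.weight with h0 | h0
      · right
        rw [eq_one_of_weight_eq_zero h0, h1 b (by omega)]
      · left
        rw [eq_one_of_weight_eq_zero (t := b) (by omega), h1 a (by omega)]
  | op =>
    induction t using op_induction with
    | leaf x => simp at h
    | act a v =>
      simp only [weight_rhoT] at h
      rcases Nat.eq_zero_or_pos a.weight with h0 | h0
      · rw [eq_one_of_weight_eq_zero h0]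
        induction v using op_induction with
        | leaf x => simp [h0] at h
        | act b w =>
          simp only [weight_rhoT] at h
          rw [eq_one_of_weight_eq_zero (t := b) (by omega),
            eq_one_of_weight_eq_zero (t := w) (by omega)]
          exact ⟨_, _, _, .rho, .inr rfl⟩
        | pt b =>
          simp only [weight_fT] at h
          rw [eq_one_of_weight_eq_zero (t := b) (by omega)]
          exact ⟨_, _, _, .f, .inr rfl⟩
      · rw [h1 a (by omega), eq_one_of_weight_eq_zero (t := v) (by omega)]
        exact ⟨_, _, _, .rho, .inl rfl⟩
    | pt a =>
      simp only [weight_fT] at h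
      rw [h1 a (by omega)]
      exact ⟨_, _, _, .f, .inl rfl⟩

theorem Basic.unique {J : List Colour} {c : Colour} {t₁ t₂ t₁' t₂' : PTree Gen c}
    (h : Basic J c t₁ t₂) (h' : Basic J c t₁' t₂') : t₁' = t₁ ∧ t₂' = t₂ := by
  cases h <;> cases h' <;> exact ⟨rfl, rfl⟩

/-- Every tree of weight two occurs in a relation, and the sequence of inputs determines which one.
-/
theorem Basic.eq_or_eq {J : List Colour} {c : Colour} {t₁ t₂ : PTree Gen c} (h : Basic J c t₁ t₂)
    {t : PTree Gen c} (hJ : t.leaves = J) (ht : t.weight = 2) : t = t₁ ∨ t = t₂ := by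
  obtain ⟨J', t₁', t₂', h', ht'⟩ := exists_basic t ht
  have : J' = J := by
    rcases ht' with rfl | rfl
    · rw [← hJ, h'.leaves_eq.1]
    · rw [← hJ, h'.leaves_eq.2.1]
  subst this
  obtain ⟨rfl, rfl⟩ := h.unique h'
  exact ht'

end HSC₁

/-! ### Bilinear extensions of operations on bases. -/

section Bil

variable {k : Type*} [Field k] {α β γ : Type*}

/-- The bilinear extension of a map of bases. -/
noncomputable def bil (k : Type*) [Field k] (φ : α → β → γ) :
    (α →₀ k) →ₗ[k] (β →₀ k) →ₗ[k] (γ →₀ k) :=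
  Finsupp.linearCombination k fun a => Finsupp.lmapDomain k k (φ a)

theorem bil_single_left (φ : α → β → γ) (a : α) (y : β →₀ k) :
    bil k φ (Finsupp.single a 1) y = y.mapDomain (φ a) := by
  simp [bil]

theorem bil_single_right (φ : α → β → γ) (x : α →₀ k) (b : β) :
    bil k φ x (Finsupp.single b 1) = x.mapDomain fun a => φ a b := by
  induction x using Finsupp.induction_linear with
  | zero => simp
  | add x y hx hy => rw [map_add, LinearMap.add_apply, hx, hy, Finsupp.mapDomain_add]
  | single a r =>
    rw [bil, Finsupp.linearCombination_single, LinearMap.smul_apply, Finsupp.lmapDomain_apply,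
      Finsupp.mapDomain_single, Finsupp.mapDomain_single, Finsupp.smul_single, smul_eq_mul, mul_one]

@[simp] theorem bil_single_single (φ : α → β → γ) (a : α) (b : β) :
    bil k φ (Finsupp.single a 1) (Finsupp.single b 1) = Finsupp.single (φ a b) 1 := by
  rw [bil_single_left, Finsupp.mapDomain_single]

/-- Injectivity makes the factorization of a basis element unique, so a single product contributes.
-/
theorem bil_apply (φ : α → β → γ) (hφ : Function.Injective2 φ) (x : α →₀ k) (y : β →₀ k)
    (a : α) (b : β) : bil k φ x y (φ a b) = x a * y b := by
  classical
  induction x using Finsupp.induction_linear with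
  | zero => simp
  | add x x' hx hx' => simp [hx, hx', add_mul]
  | single a' r =>
    rw [bil, Finsupp.linearCombination_single, LinearMap.smul_apply, Finsupp.lmapDomain_apply,
      Finsupp.smul_apply, smul_eq_mul]
    by_cases h : a' = a
    · subst h
      rw [Finsupp.mapDomain_apply (hφ.right a'), Finsupp.single_eq_same]
    · rw [Finsupp.mapDomain_of_notMem_range, Finsupp.single_apply, if_neg h, mul_zero, zero_mul]
      rintro ⟨b', hb'⟩
      exact h (hφ hb').1

theorem bil_apply_of_notMem (φ : α → β → γ) (x : α →₀ k) (y : β →₀ k) (c : γ)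
    (hc : ∀ a b, φ a b ≠ c) : bil k φ x y c = 0 := by
  induction x using Finsupp.induction_linear with
  | zero => simp
  | add x x' hx hx' => simp [hx, hx']
  | single a' r =>
    rw [bil, Finsupp.linearCombination_single, LinearMap.smul_apply, Finsupp.lmapDomain_apply,
      Finsupp.smul_apply, Finsupp.mapDomain_of_notMem_range, smul_zero]
    rintro ⟨b', hb'⟩
    exact hc _ _ hb'

/-- Bilinear maps that agree on basis elements of two supports agree. -/
theorem bil_ext {M : Type*} [AddCommGroup M] [Module k M] {f g : (α →₀ k) →ₗ[k] (β →₀ k) →ₗ[k] M}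
    {S : Set α} {S' : Set β}
    (h : ∀ a ∈ S, ∀ b ∈ S', f (Finsupp.single a 1) (Finsupp.single b 1) =
      g (Finsupp.single a 1) (Finsupp.single b 1))
    {x : α →₀ k} (hx : x ∈ Finsupp.supported k k S) {y : β →₀ k}
    (hy : y ∈ Finsupp.supported k k S') : f x y = g x y := by
  rw [Finsupp.supported_eq_span_single] at hx hy
  induction hx using Submodule.span_induction with
  | mem _ hx =>
    obtain ⟨a, ha, rfl⟩ := hx
    induction hy using Submodule.span_induction with
    | mem _ hy => obtain ⟨b, hb, rfl⟩ := hy; exact h a ha b hb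
    | zero => simp
    | add _ _ _ _ h h' => rw [map_add, map_add, h, h']
    | smul _ _ _ h => rw [map_smul, map_smul, h]
  | zero => simp
  | add _ _ _ _ h h' => rw [map_add, map_add, LinearMap.add_apply, LinearMap.add_apply, h, h']
  | smul _ _ _ h => rw [map_smul, map_smul, LinearMap.smul_apply, LinearMap.smul_apply, h]

end Bil

/-! ### Signed sums of trees, products of two-level trees and their differentials. -/

namespace HSC₁

open Colour

theorem muT_injective2 {X : Colour → Type} : Function.Injective2 (muT (X := X)) := by
  intro a a' b b' h
  unfold muT at h
  injection h with _ _ _ h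
  exact ⟨congrFun h ⟨0, by simp⟩, congrFun h ⟨1, by simp⟩⟩

theorem rhoT_injective2 {X : Colour → Type} : Function.Injective2 (rhoT (X := X)) := by
  intro a a' b b' h
  unfold rhoT at h
  injection h with _ _ _ h
  exact ⟨congrFun h ⟨0, by simp⟩, congrFun h ⟨1, by simp⟩⟩

theorem fT_injective {X : Colour → Type} : Function.Injective (fT (X := X)) := by
  intro a a' h
  unfold fT at h
  injection h with _ _ _ h
  exact congrFun h ⟨0, by simp⟩

variable (k : Type*) [Field k] (X : Colour → Type)

/-- The bilinear extension of `μ`. -/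
noncomputable abbrev mulL :
    (Tree Gen X cl →₀ k) →ₗ[k] (Tree Gen X cl →₀ k) →ₗ[k] (Tree Gen X cl →₀ k) :=
  bil k muT

/-- The combinations of trees with open output and of a marked point. -/
abbrev Pointed : Type _ := k × (Tree Gen X op →₀ k)

/-- The bilinear extension of `ρ` and of `f`, which acts on the marked point. -/
noncomputable def actL : (Tree Gen X cl →₀ k) →ₗ[k] Pointed k X →ₗ[k] Pointed k X :=
  LinearMap.mk₂ k (fun x y => (0, y.1 • x.mapDomain fT + bil k rhoT x y.2))
    (fun x x' y => by simp [Finsupp.mapDomain_add]; abel)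
    (fun a x y => by simp [Finsupp.mapDomain_smul, smul_comm a])
    (fun x y y' => by simp [add_smul]; abel)
    (fun a x y => by simp [mul_smul])

@[simp] theorem actL_fst (x : Tree Gen X cl →₀ k) (y : Pointed k X) : (actL k X x y).1 = 0 := rfl

theorem actL_snd (x : Tree Gen X cl →₀ k) (y : Pointed k X) :
    (actL k X x y).2 = y.1 • x.mapDomain fT + bil k rhoT x y.2 := rfl

/-- The sum with signs of the trees `μ(…)` of weight `n`. -/
noncomputable def cogen (n : ℕ) : PTree Gen cl →₀ k :=
  assocSum (mulL k _) n fun _ => Finsupp.single (.leaf PUnit.unit) 1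

/-- The last factor of given kind. -/
noncomputable def lastFactor (κ : Bool) : Pointed k fun _ => PUnit :=
  if κ then (0, Finsupp.single (.leaf PUnit.unit) 1) else (1, 0)

/-- The sum with signs of the trees with open output of weight `n` and of kind `κ`. -/
noncomputable def cogenOp (κ : Bool) (n : ℕ) : Pointed k fun _ => PUnit :=
  actSum (mulL k _) (actL k _) n (fun _ => Finsupp.single (.leaf PUnit.unit) 1) (lastFactor k κ)

variable {k X}

theorem muT_ne_leaf (a b : Tree Gen X cl) (x : X cl) : muT a b ≠ .leaf x := by
  intro h; have := congrArg Tree.weight h; simp at this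

theorem rhoT_ne_leaf (a : Tree Gen X cl) (v : Tree Gen X op) (x : X op) : rhoT a v ≠ .leaf x := by
  intro h; have := congrArg Tree.weight h; simp at this

theorem fT_ne_leaf (a : Tree Gen X cl) (x : X op) : fT a ≠ .leaf x := by
  intro h; have := congrArg Tree.weight h; simp at this

theorem rhoT_ne_fT (a b : Tree Gen X cl) (v : Tree Gen X op) : rhoT a v ≠ fT b := by
  unfold rhoT fT
  intro h
  injection h with h
  simp at h

theorem shift_const {T : Type*} (i : ℕ) (a : T) : (shift i fun _ => a) = fun _ => a := rfl

/-- A tree factors uniquely at its root, so the recursion contributes one term, whose sign is the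
factor of the root in `sgn`. -/
theorem cogen_apply (n : ℕ) (t : PTree Gen cl) :
    cogen k n t = if t.weight = n then sgn k t else 0 := by
  classical
  induction n using Nat.strong_induction_on generalizing t with
  | _ n ih =>
    unfold cogen at ih ⊢
    cases n with
    | zero =>
      rw [assocSum_zero]
      induction t using cl_induction with
      | leaf x => simp
      | mul a b =>
        rw [Finsupp.single_apply, if_neg (Ne.symm (muT_ne_leaf a b _)), if_neg (by simp)]
    | succ n =>
      rw [assocSum_succ, Finsupp.finsetSum_apply]
      simp only [Finsupp.smul_apply]
      induction t using cl_induction with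
      | leaf x =>
        rw [if_neg (by simp)]
        refine Finset.sum_eq_zero fun p _ => ?_
        rw [bil_apply_of_notMem _ _ _ _ fun a b => muT_ne_leaf a b x, smul_zero]
      | mul a b =>
        have e : ∀ p ∈ Finset.HasAntidiagonal.antidiagonal n, (-1 : k) ^ p.1 •
            mulL k _ (assocSum (mulL k _) p.1 fun _ => Finsupp.single (.leaf PUnit.unit) 1)
              (assocSum (mulL k _) p.2
                (shift (p.1 + 1) fun _ => Finsupp.single (.leaf PUnit.unit) 1)) (muT a b) =
            if p = (a.weight, b.weight) then sgn k (muT a b) else 0 := by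
          intro p hp
          have := add_eq_of_mem_antidiagonal hp
          rw [bil_apply _ muT_injective2, ih _ (by omega)]
          have h2 := ih p.2 (by omega) b
          rw [shift_const, h2]
          obtain ⟨i, j⟩ := p
          by_cases h1 : a.weight = i
          · by_cases h3 : b.weight = j
            · simp [h1, h3]
            · simp [h1, h3, Ne.symm h3]
          · simp [h1, Ne.symm h1]
        rw [Finset.sum_congr rfl e, Finset.sum_ite_eq']
        simp

/-- The root is now `ρ` or `f`. Trees with root `f` come from products with the marked point,
present only in `cogenOp` of weight zero and kind `false`. -/
theorem cogenOp_apply (κ : Bool) (n : ℕ) :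
    (cogenOp k κ n).1 = (if n = 0 ∧ κ = false then 1 else 0) ∧ ∀ t : PTree Gen op,
    (cogenOp k κ n).2 t = if t.weight = n ∧ lastOpen t = κ then sgn k t else 0 := by
  classical
  induction n using Nat.strong_induction_on with
  | _ n ih =>
    unfold cogenOp at ih ⊢
    cases n with
    | zero =>
      rw [actSum_zero, lastFactor]
      refine ⟨by cases κ <;> simp, fun t => ?_⟩
      induction t using op_induction with
      | leaf x => cases κ <;> simp
      | act a v =>
        rw [if_neg (c := _ ∧ _) (by simp)]
        cases κ <;> simp [Ne.symm (rhoT_ne_leaf a v _)]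
      | pt a =>
        rw [if_neg (c := _ ∧ _) (by simp)]
        cases κ <;> simp [Ne.symm (fT_ne_leaf a _)]
    | succ n =>
      rw [actSum_succ]
      refine ⟨by simp [Prod.fst_sum], fun t => ?_⟩
      rw [Prod.snd_sum, Finsupp.finsetSum_apply]
      have e : ∀ p ∈ Finset.HasAntidiagonal.antidiagonal n, ((-1 : k) ^ p.1 •
            actL k _ (assocSum (mulL k _) p.1 fun _ => Finsupp.single (.leaf PUnit.unit) 1)
              (actSum (mulL k _) (actL k _) p.2
                (shift (p.1 + 1) fun _ => Finsupp.single (.leaf PUnit.unit) 1)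
                (lastFactor k κ))).2 t =
            (-1 : k) ^ p.1 * (((if p.2 = 0 ∧ κ = false then 1 else 0) *
              (cogen k p.1).mapDomain fT t) +
              bil k rhoT (cogen k p.1) (cogenOp k κ p.2).2 t) := by
        intro p hp
        have := add_eq_of_mem_antidiagonal hp
        have h1 := (ih p.2 (by omega)).1
        simp only [shift_const, Prod.smul_snd, Finsupp.smul_apply, actL_snd, h1, smul_eq_mul,
          Finsupp.add_apply]
        rfl
      rw [Finset.sum_congr rfl e]
      induction t using op_induction with
      | leaf x =>
        rw [if_neg (by simp)]
        refine Finset.sum_eq_zero fun p _ => ?_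
        rw [bil_apply_of_notMem _ _ _ _ fun a b => rhoT_ne_leaf a b x,
          Finsupp.mapDomain_of_notMem_range]
        · simp
        · rintro ⟨a, ha⟩
          exact fT_ne_leaf a x ha
      | act a v =>
        have e : ∀ p ∈ Finset.HasAntidiagonal.antidiagonal n,
            (-1 : k) ^ p.1 * (((if p.2 = 0 ∧ κ = false then 1 else 0) *
              (cogen k p.1).mapDomain fT (rhoT a v)) +
              bil k rhoT (cogen k p.1) (cogenOp k κ p.2).2 (rhoT a v)) =
            if p = (a.weight, v.weight) then
              (if lastOpen v = κ then sgn k (rhoT a v) else 0) else 0 := by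
          intro p hp
          have := add_eq_of_mem_antidiagonal hp
          rw [bil_apply _ rhoT_injective2, cogen_apply, Finsupp.mapDomain_of_notMem_range]
          · have h2 := (ih p.2 (by omega)).2 v
            rw [cogenOp, h2]
            obtain ⟨i, j⟩ := p
            by_cases h1 : a.weight = i
            · by_cases h3 : v.weight = j
              · simp [h1, h3]
              · simp [h1, h3, Ne.symm h3]
            · simp [h1, Ne.symm h1]
          · rintro ⟨b, hb⟩
            exact rhoT_ne_fT _ _ _ hb.symm
        rw [Finset.sum_congr rfl e, Finset.sum_ite_eq']
        simp only [Finset.HasAntidiagonal.mem_antidiagonal, weight_rhoT, add_left_inj,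
          lastOpen_rhoT]
        rw [← ite_and]
      | pt a =>
        have e : ∀ p ∈ Finset.HasAntidiagonal.antidiagonal n,
            (-1 : k) ^ p.1 * (((if p.2 = 0 ∧ κ = false then 1 else 0) *
              (cogen k p.1).mapDomain fT (fT a)) +
              bil k rhoT (cogen k p.1) (cogenOp k κ p.2).2 (fT a)) =
            if p = (a.weight, 0) then (if κ = false then sgn k (fT a) else 0) else 0 := by
          intro p hp
          rw [bil_apply_of_notMem _ _ _ _ fun b v => rhoT_ne_fT b a v,
            Finsupp.mapDomain_apply fT_injective, cogen_apply]
          obtain ⟨i, j⟩ := p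
          by_cases h1 : a.weight = i
          · by_cases h3 : j = 0
            · simp [h1, h3]
            · simp [h1, h3]
          · simp [h1, Ne.symm h1]
        rw [Finset.sum_congr rfl e, Finset.sum_ite_eq']
        simp only [Finset.HasAntidiagonal.mem_antidiagonal, weight_fT, add_left_inj, lastOpen_fT,
          add_zero]
        rw [← ite_and]
        simp only [eq_comm (a := κ)]

/-! ### The Koszul dual cooperad -/

variable (k) in
/-- The Koszul dual cooperad. -/
noncomputable def dual (I : List Colour) (s : Colour) : Submodule k (PTree Gen s →₀ k) :=
  (hsc₁ k).koszulDual I s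

theorem mem_koszulDual {I : List Colour} {s : Colour} {x : PTree Gen s →₀ k} :
    x ∈ dual k I s ↔ (x ∈ Finsupp.supported k k {t : PTree Gen s | t.leaves = I} ∧
      ∀ (J : List Colour) (c : Colour) (C : Context Gen (fun _ => PUnit) c s)
        (u : ℕ → (c : Colour) → PTree Gen c),
        ∃ r ∈ Submodule.span k (relations k J c), ∀ t : PTree Gen c, t.leaves = J → t.weight = 2 →
          r t = (-1) ^ t.crossings u * x (C.plug (t.subst u))) := Iff.rfl

/-- The trees with two vertices and given inputs are the two terms of one relation, if there are
any. Being a multiple of `t₁ - t₂` then means having opposite coefficients at these two trees. -/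
theorem mem_koszulDual_iff {I : List Colour} {s : Colour} {x : PTree Gen s →₀ k} :
    x ∈ dual k I s ↔ (∀ t, x t ≠ 0 → t.leaves = I) ∧
      ∀ (J : List Colour) (c : Colour) (t₁ t₂ : PTree Gen c), Basic J c t₁ t₂ →
        ∀ (C : Context Gen (fun _ => PUnit) c s) (u : ℕ → (c : Colour) → PTree Gen c),
          x (C.plug (t₁.subst u)) = -(-1) ^ t₂.crossings u * x (C.plug (t₂.subst u)) := by
  rw [mem_koszulDual]
  constructor
  · rintro ⟨h1, h2⟩
    refine ⟨fun t ht => (Finsupp.mem_supported _ _).1 h1 (Finsupp.mem_support_iff.2 ht), ?_⟩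
    intro J c t₁ t₂ h C u
    obtain ⟨r, hr, hrx⟩ := h2 J c C u
    rw [h.relations, Submodule.mem_span_singleton] at hr
    obtain ⟨a, rfl⟩ := hr
    obtain ⟨l1, l2, w1, w2⟩ := h.leaves_eq
    have e1 := hrx t₁ l1 w1
    have e2 := hrx t₂ l2 w2
    rw [h.crossings_eq_zero u] at e1
    simp only [Finsupp.smul_apply, Finsupp.sub_apply, Finsupp.single_eq_same,
      Finsupp.single_eq_of_ne h.ne, Finsupp.single_eq_of_ne h.ne.symm, sub_zero, zero_sub,
      smul_eq_mul, mul_one, mul_neg, pow_zero, one_mul] at e1 e2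
    refine e1.symm.trans ?_
    rw [neg_mul]
    exact eq_neg_of_add_eq_zero_left (by rw [← neg_eq_iff_add_eq_zero]; exact e2)
  · rintro ⟨h1, h2⟩
    refine ⟨(Finsupp.mem_supported _ _).2 fun t ht => h1 t (Finsupp.mem_support_iff.1 ht), ?_⟩
    intro J c C u
    by_cases hJ : ∃ t₁ t₂, Basic J c t₁ t₂
    · obtain ⟨t₁, t₂, h⟩ := hJ
      refine ⟨x (C.plug (t₁.subst u)) • (Finsupp.single t₁ 1 - Finsupp.single t₂ 1),
        Submodule.smul_mem _ _ (Submodule.subset_span ?_), fun t ht hw => ?_⟩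
      · rw [h.relations]; rfl
      · rcases h.eq_or_eq ht hw with rfl | rfl
        · rw [h.crossings_eq_zero u]
          simp [Finsupp.single_eq_of_ne h.ne]
        · have := h2 J c t₁ t h C u
          simp [Finsupp.single_eq_of_ne h.ne.symm]
          rw [this]
          simp
    · refine ⟨0, Submodule.zero_mem _, fun t ht hw => ?_⟩
      obtain ⟨J', t₁, t₂, h, ht'⟩ := exists_basic t hw
      refine (hJ ?_).elim
      rcases ht' with rfl | rfl
      · rw [← ht, h.leaves_eq.1]; exact ⟨_, _, h⟩
      · rw [← ht, h.leaves_eq.2.1]; exact ⟨_, _, h⟩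

/-- The sum with signs of the trees with a given profile belongs to the Koszul dual cooperad. -/
theorem mem_koszulDual_of_apply {s : Colour} (n : ℕ) (κ : Bool) (I : List Colour)
    (hI : ∀ t : PTree Gen s, t.weight = n → lastOpen t = κ → t.leaves = I)
    {x : PTree Gen s →₀ k}
    (hx : ∀ t, x t = if t.weight = n ∧ lastOpen t = κ then sgn k t else 0) :
    x ∈ dual k I s := by
  classical
  refine mem_koszulDual_iff.2 ⟨fun t ht => ?_, fun J c t₁ t₂ h C u => ?_⟩
  · rw [hx] at ht
    have := (ite_ne_right_iff.1 ht).1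
    exact hI t this.1 this.2
  · obtain ⟨h1, h2, h3⟩ := (h.signRel k u).plug C
    rw [hx, hx, h1, h2, h3]
    split_ifs <;> simp

/-- One rewriting changes a coefficient by a sign only, so vanishing spreads over a whole
equivalence class. -/
theorem Rot.eq_zero_iff {I : List Colour} {s : Colour} {x : PTree Gen s →₀ k}
    (hx : x ∈ dual k I s) {t t' : PTree Gen s} (h : Rot t t') :
    x t = 0 ↔ x t' = 0 := by
  induction h with
  | refl => rfl
  | symm _ ih => exact (ih hx).symm
  | trans _ _ ih ih' => exact (ih hx).trans (ih' hx)
  | basic h C u =>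
    rw [(mem_koszulDual_iff.1 hx).2 _ _ _ _ h C u]
    simp

/-- A nonzero element of the Koszul dual cooperad is a multiple of a sum with signs of the trees
with a given profile. -/
theorem eq_smul_of_mem_koszulDual {I : List Colour} {s : Colour} {x : PTree Gen s →₀ k}
    (hx : x ∈ dual k I s) (t₀ : PTree Gen s) (h₀ : t₀.leaves = I)
    {y : PTree Gen s →₀ k} (hy : ∀ t, y t =
      if t.weight = t₀.weight ∧ lastOpen t = lastOpen t₀ then sgn k t else 0) :
    x = (x t₀ * sgn k t₀) • y := by
  have hy' : y ∈ dual k I s := mem_koszulDual_of_apply t₀.weight (lastOpen t₀) I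
    (fun t h h' => (leaves_eq h h').trans h₀) hy
  -- The multiple is chosen to cancel the coefficient at `t₀`, using that `sgn` squares to one. The
  -- difference then vanishes at every tree with the leaves of `t₀`.
  have hz := Submodule.sub_mem _ hx (Submodule.smul_mem _ (x t₀ * sgn k t₀) hy')
  rw [← sub_eq_zero]
  ext t
  by_contra ht
  have h1 := (mem_koszulDual_iff.1 hz).1 t ht
  refine ht ((Rot.eq_zero_iff hz (rot_of_leaves_eq (h1.trans h₀.symm))).2 ?_)
  rw [Finsupp.sub_apply, Finsupp.smul_apply, hy, if_pos ⟨rfl, rfl⟩, smul_eq_mul, mul_assoc,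
    sgn_mul_self, mul_one, sub_self]

variable (k : Type*) [Field k]

/-! ### The ideals -/

/-- The operadic ideal. -/
noncomputable def opIdeal (s : Colour) : Submodule k (PTree Gen s →₀ k) := (hsc₁ k).ideal s

/-- Two-level trees. -/
abbrev Tree₂ (s : Colour) : Type := Tree Gen (PTree Gen) s

/-- The combinations of two-level trees with one label in the operadic ideal. -/
noncomputable def labIdeal (s : Colour) : Submodule k (Tree₂ s →₀ k) := (hsc₁ k).idealLabels s

/-- The differential of two-level trees. -/
noncomputable def diffL (s : Colour) : (Tree₂ s →₀ k) →ₗ[k] (Tree₂ s →₀ k) := (hsc₁ k).diffFree s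

variable {k}

theorem opIdeal_eq_span (s : Colour) : opIdeal k s =
    Submodule.span k {y | ∃ (I : List Colour) (c : Colour) (r : PTree Gen c →₀ k)
      (C : Context Gen (fun _ => PUnit) c s) (u : ℕ → (c : Colour) → PTree Gen c),
      r ∈ Submodule.span k (relations k I c) ∧ y = r.mapDomain fun t => C.plug (t.subst u)} := rfl

theorem labIdeal_eq_span (s : Colour) : labIdeal k s =
    Submodule.span k {y | ∃ (c : Colour) (C : Context Gen (PTree Gen) c s), ∃ r ∈ opIdeal k c,
      y = r.mapDomain fun t => C.plug (Tree.leaf t)} := rfl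

theorem Rot.sub_mem {s : Colour} {t t' : PTree Gen s} (h : Rot t t') :
    Finsupp.single t 1 - Finsupp.single t' 1 ∈ opIdeal k s := by
  induction h with
  | refl => rw [sub_self]; exact Submodule.zero_mem _
  | symm _ ih => rw [← neg_sub]; exact Submodule.neg_mem _ ih
  | trans _ _ ih ih' => rw [← sub_add_sub_cancel]; exact Submodule.add_mem _ ih ih'
  | @basic J c s t₁ t₂ h C u =>
    rw [opIdeal_eq_span]
    refine Submodule.subset_span ⟨J, c, Finsupp.single t₁ 1 - Finsupp.single t₂ 1, C, u,
      Submodule.subset_span (by rw [h.relations]; rfl), ?_⟩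
    rw [sub_eq_add_neg, sub_eq_add_neg, Finsupp.mapDomain_add, ← Finsupp.single_neg,
      ← Finsupp.single_neg, Finsupp.mapDomain_single, Finsupp.mapDomain_single]

/-- A linear map that takes equal values on equivalent trees vanishes on the ideal. -/
theorem map_eq_zero_of_mem_opIdeal {M : Type*} [AddCommGroup M] [Module k M] {s : Colour}
    (F : (PTree Gen s →₀ k) →ₗ[k] M)
    (hF : ∀ t t', Rot t t' → F (Finsupp.single t 1) = F (Finsupp.single t' 1))
    {y : PTree Gen s →₀ k} (hy : y ∈ opIdeal k s) : F y = 0 := by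
  rw [opIdeal_eq_span] at hy
  induction hy using Submodule.span_induction with
  | mem y hy =>
    obtain ⟨J, c, r, C, u, hr, rfl⟩ := hy
    induction hr using Submodule.span_induction with
    | mem r hr =>
      obtain ⟨t₁, t₂, h, rfl⟩ := mem_relations hr
      rw [sub_eq_add_neg, Finsupp.mapDomain_add, ← Finsupp.single_neg, Finsupp.mapDomain_single,
        Finsupp.mapDomain_single, Finsupp.single_neg, map_add, map_neg,
        hF _ _ (.basic h C u), add_neg_cancel]
    | zero => simp
    | add x y _ _ hx hy => rw [Finsupp.mapDomain_add, map_add, hx, hy, add_zero]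
    | smul a x _ hx => rw [Finsupp.mapDomain_smul, map_smul, hx, smul_zero]
  | zero => simp
  | add x y _ _ hx hy => rw [map_add, hx, hy, add_zero]
  | smul a x _ hx => rw [map_smul, hx, smul_zero]

/-- A linear map that takes equal values on trees with equivalent labels vanishes on the
combinations of two-level trees with one label in the ideal. -/
theorem map_eq_zero_of_mem_labIdeal {M : Type*} [AddCommGroup M] [Module k M] {s : Colour}
    (F : (Tree₂ s →₀ k) →ₗ[k] M)
    (hF : ∀ (c : Colour) (C : Context Gen (PTree Gen) c s) (t t' : PTree Gen c), Rot t t' →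
      F (Finsupp.single (C.plug (.leaf t)) 1) = F (Finsupp.single (C.plug (.leaf t')) 1))
    {y : Tree₂ s →₀ k} (hy : y ∈ labIdeal k s) : F y = 0 := by
  rw [labIdeal_eq_span] at hy
  induction hy using Submodule.span_induction with
  | mem y hy =>
    obtain ⟨c, C, r, hr, rfl⟩ := hy
    exact map_eq_zero_of_mem_opIdeal (F ∘ₗ Finsupp.lmapDomain k k fun t => C.plug (.leaf t))
      (fun t t' h => by simpa using hF c C t t' h) hr
  | zero => simp
  | add x y _ _ hx hy => rw [map_add, hx, hy, add_zero]
  | smul a x _ hx => rw [map_smul, hx, smul_zero]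

theorem Rot.leaf_sub_mem {s : Colour} {t t' : PTree Gen s} (h : Rot t t') :
    Finsupp.single (Tree.leaf t : Tree₂ s) 1 - Finsupp.single (Tree.leaf t') 1 ∈ labIdeal k s := by
  rw [labIdeal_eq_span]
  refine Submodule.subset_span ⟨s, .hole, _, h.sub_mem (k := k), ?_⟩
  rw [sub_eq_add_neg, sub_eq_add_neg, Finsupp.mapDomain_add, ← Finsupp.single_neg,
    ← Finsupp.single_neg, Finsupp.mapDomain_single, Finsupp.mapDomain_single]
  rfl

theorem labIdeal_node {I : List Colour} {s : Colour} (g : Gen I s)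
    (t : (j : Fin I.length) → Tree₂ (I.get j)) (i : Fin I.length) {x : Tree₂ (I.get i) →₀ k}
    (hx : x ∈ labIdeal k (I.get i)) :
    (x.mapDomain fun v => (Tree.node g (Function.update t i v) : Tree₂ s)) ∈ labIdeal k s :=
  (hsc₁ k).idealLabels_node g t i hx

theorem bil_mem {α β γ : Type*} {φ : α → β → γ} {N : Submodule k (γ →₀ k)} {y : β →₀ k}
    (h : ∀ a, y.mapDomain (φ a) ∈ N) (x : α →₀ k) : bil k φ x y ∈ N := by
  induction x using Finsupp.induction_linear with
  | zero => simp
  | add x x' hx hx' => rw [map_add, LinearMap.add_apply]; exact Submodule.add_mem _ hx hx'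
  | single a r =>
    rw [bil, Finsupp.linearCombination_single, LinearMap.smul_apply]
    exact Submodule.smul_mem _ _ (h a)

theorem bil_mem' {α β γ : Type*} {φ : α → β → γ} {N : Submodule k (γ →₀ k)} {x : α →₀ k}
    (h : ∀ b, x.mapDomain (fun a => φ a b) ∈ N) (y : β →₀ k) : bil k φ x y ∈ N := by
  induction y using Finsupp.induction_linear with
  | zero => simp
  | add x x' hx hx' => rw [map_add]; exact Submodule.add_mem _ hx hx'
  | single a r =>
    rw [← mul_one r, ← smul_eq_mul, ← Finsupp.smul_single, map_smul, bil_single_right]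
    exact Submodule.smul_mem _ _ (h a)

theorem mulL_mem_left {x : Tree₂ cl →₀ k} (hx : x ∈ labIdeal k cl) (y : Tree₂ cl →₀ k) :
    mulL k _ x y ∈ labIdeal k cl := by
  refine bil_mem' (fun b => ?_) y
  have := labIdeal_node Gen.mu (fun | ⟨0, _⟩ => b | ⟨1, _⟩ => b) ⟨0, by simp⟩ hx
  simp only [node_mu] at this
  exact this

theorem mulL_mem_right (x : Tree₂ cl →₀ k) {y : Tree₂ cl →₀ k} (hy : y ∈ labIdeal k cl) :
    mulL k _ x y ∈ labIdeal k cl := by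
  refine bil_mem (fun a => ?_) x
  have := labIdeal_node Gen.mu (fun | ⟨0, _⟩ => a | ⟨1, _⟩ => a) ⟨1, by simp⟩ hy
  simp only [node_mu] at this
  exact this

theorem rhoL_mem_left {x : Tree₂ cl →₀ k} (hx : x ∈ labIdeal k cl) (y : Tree₂ op →₀ k) :
    bil k rhoT x y ∈ labIdeal k op := by
  refine bil_mem' (fun b => ?_) y
  have := labIdeal_node Gen.rho (fun | ⟨0, _⟩ => .leaf (one cl) | ⟨1, _⟩ => b) ⟨0, by simp⟩ hx
  simp only [node_rho] at this
  exact this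

theorem rhoL_mem_right (x : Tree₂ cl →₀ k) {y : Tree₂ op →₀ k} (hy : y ∈ labIdeal k op) :
    bil k rhoT x y ∈ labIdeal k op := by
  refine bil_mem (fun a => ?_) x
  have := labIdeal_node Gen.rho (fun | ⟨0, _⟩ => a | ⟨1, _⟩ => .leaf (one op)) ⟨1, by simp⟩ hy
  simp only [node_rho] at this
  exact this

theorem mapDomain_fT_mem {x : Tree₂ cl →₀ k} (hx : x ∈ labIdeal k cl) :
    x.mapDomain fT ∈ labIdeal k op := by
  have := labIdeal_node Gen.f (fun | ⟨0, _⟩ => .leaf (one cl)) ⟨0, by simp⟩ hx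
  simp only [node_f] at this
  exact this

variable (k) in
/-- The combinations with one label in the ideal, among those with a marked point. -/
noncomputable def pointedIdeal : Submodule k (Pointed k (PTree Gen)) :=
  (⊥ : Submodule k k).prod (labIdeal k op)

theorem actL_mem_left {x : Tree₂ cl →₀ k} (hx : x ∈ labIdeal k cl) (y : Pointed k (PTree Gen)) :
    actL k _ x y ∈ pointedIdeal k :=
  ⟨Submodule.zero_mem _, Submodule.add_mem _ (Submodule.smul_mem _ _ (mapDomain_fT_mem hx))
    (rhoL_mem_left hx _)⟩

theorem actL_mem_right (x : Tree₂ cl →₀ k) {y : Pointed k (PTree Gen)} (hy : y ∈ pointedIdeal k) :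
    actL k _ x y ∈ pointedIdeal k := by
  refine ⟨Submodule.zero_mem _, ?_⟩
  rw [actL_snd, (Submodule.mem_bot k).1 hy.1, zero_smul, zero_add]
  exact rhoL_mem_right x hy.2

/-! ### Labels -/

variable (k) in
/-- A two-level tree with only one label. -/
noncomputable def lab {s : Colour} (t : PTree Gen s) : Tree₂ s →₀ k := Finsupp.single (.leaf t) 1

variable (k) in
/-- An end as an element of the combinations with a marked point. -/
noncomputable def inc : End → Pointed k (PTree Gen)
  | none => (1, 0)
  | some v => (0, lab k v)

theorem inc_sub_mem {e e' : End} (h : Option.Rel Rot e e') :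
    inc k e - inc k e' ∈ pointedIdeal k := by
  cases h with
  | none => rw [sub_self]; exact Submodule.zero_mem _
  | some h => exact ⟨by simp [inc], h.leaf_sub_mem⟩

/-! ### The differential -/

@[simp] theorem diffL_single {s : Colour} (t : Tree₂ s) :
    diffL k s (Finsupp.single t 1) = (hsc₁ k).diffTree t := by
  change Finsupp.linearCombination k (fun t : Tree₂ s => ((hsc₁ k).diffTree t : Tree₂ s →₀ k))
    (Finsupp.single t 1) = _
  rw [Finsupp.linearCombination_single, one_smul]

theorem diffTree_node {I : List Colour} {s : Colour} (g : Gen I s)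
    (t : (i : Fin I.length) → Tree₂ (I.get i)) :
    diffL k s (Finsupp.single (Tree.node g t) 1) =
      (if ∀ i, (t i).weight = 0 then
        Finsupp.single (Tree.leaf (.node g fun i => (t i).join) : Tree₂ s) (1 : k) else 0) +
      ∑ i, (-1 : k) ^ (1 + ∑ j ∈ Finset.Iio i, (t j).weight) •
        (diffL k (I.get i) (Finsupp.single (t i) 1)).mapDomain
          fun w => (.node g (Function.update t i w) : Tree₂ s) := by
  simp only [diffL_single]
  rfl

theorem diffL_single_leaf {s : Colour} (t : PTree Gen s) :
    diffL k s (Finsupp.single (Tree.leaf t) 1) = 0 := by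
  rw [diffL_single]
  rfl

theorem diffL_lab {s : Colour} (t : PTree Gen s) : diffL k s (lab k t) = 0 := diffL_single_leaf t

theorem diffL_muT (a b : Tree₂ cl) : diffL k cl (Finsupp.single (muT a b) 1) =
    (if a.weight = 0 ∧ b.weight = 0 then Finsupp.single (.leaf (muT a.join b.join)) 1 else 0) +
      (-(diffL k cl (Finsupp.single a 1)).mapDomain (fun w => muT w b) +
        (-1 : k) ^ (a.weight + 1) • (diffL k cl (Finsupp.single b 1)).mapDomain (muT a)) := by
  conv_lhs => rw [muT]
  rw [diffTree_node]
  congr 1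
  · simp only [node_mu]
    congr 1
    exact propext Fin.forall_fin_two
  · refine (Fin.sum_univ_two _).trans ?_
    congr 1
    · erw [Iio_zero]
      simp only [node_mu]
      rw [Finset.sum_empty, add_zero, pow_one, neg_one_smul]
      rfl
    · erw [Iio_one]
      simp only [node_mu]
      rw [Finset.sum_singleton, add_comm]
      rfl

theorem diffL_rhoT (a : Tree₂ cl) (v : Tree₂ op) : diffL k op (Finsupp.single (rhoT a v) 1) =
    (if a.weight = 0 ∧ v.weight = 0 then Finsupp.single (.leaf (rhoT a.join v.join)) 1 else 0) +
      (-(diffL k cl (Finsupp.single a 1)).mapDomain (fun w => rhoT w v) +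
        (-1 : k) ^ (a.weight + 1) • (diffL k op (Finsupp.single v 1)).mapDomain (rhoT a)) := by
  conv_lhs => rw [rhoT]
  rw [diffTree_node]
  congr 1
  · simp only [node_rho]
    congr 1
    exact propext Fin.forall_fin_two
  · refine (Fin.sum_univ_two _).trans ?_
    congr 1
    · erw [Iio_zero]
      simp only [node_rho]
      rw [Finset.sum_empty, add_zero, pow_one, neg_one_smul]
      rfl
    · erw [Iio_one]
      simp only [node_rho]
      rw [Finset.sum_singleton, add_comm]
      rfl

theorem diffL_fT (a : Tree₂ cl) : diffL k op (Finsupp.single (fT a) 1) =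
    (if a.weight = 0 then Finsupp.single (.leaf (fT a.join)) 1 else 0) -
      (diffL k cl (Finsupp.single a 1)).mapDomain fT := by
  conv_lhs => rw [fT]
  rw [diffTree_node, sub_eq_add_neg]
  congr 1
  · simp only [node_f]
    congr 1
    exact propext Fin.forall_fin_one
  · refine (Fin.sum_univ_one _).trans ?_
    erw [Iio_zero']
    simp only [node_f]
    rw [Finset.sum_empty, add_zero, pow_one, neg_one_smul]
    rfl

variable (k) in
/-- The combinations of trees of weight `i`. -/
noncomputable def gr {X : Colour → Type} (s : Colour) (i : ℕ) : Submodule k (Tree Gen X s →₀ k) :=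
  Finsupp.supported k k {t | t.weight = i}

variable (k) in
/-- The combinations of weight `i`, with a marked point of weight zero. -/
noncomputable def grPointed (i : ℕ) : Submodule k (Pointed k (PTree Gen)) :=
  (if i = 0 then ⊤ else ⊥ : Submodule k k).prod (gr k op i)

theorem bil_mem_gr {X : Colour → Type} {s s' s'' : Colour}
    {φ : Tree Gen X s → Tree Gen X s' → Tree Gen X s''}
    (hφ : ∀ a b, (φ a b).weight = a.weight + b.weight + 1) {i j : ℕ} {x : Tree Gen X s →₀ k}
    (hx : x ∈ gr k s i) {y : Tree Gen X s' →₀ k} (hy : y ∈ gr k s' j) :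
    bil k φ x y ∈ gr k s'' (i + j + 1) := by
  refine (Finsupp.mem_supported' _ _).2 fun t ht => ?_
  have h := bil_ext (k := k) (f := (bil k φ).compr₂ (Finsupp.lapply t)) (g := 0)
    (S := {t | t.weight = i}) (S' := {t | t.weight = j}) (fun a ha b hb => ?_) hx hy
  · exact h
  · change (bil k φ (Finsupp.single a 1) (Finsupp.single b 1)) t = 0
    rw [bil_single_single, Finsupp.single_eq_of_ne]
    rintro rfl
    refine ht ?_
    change (φ a b).weight = _
    rw [hφ, show a.weight = i from ha, show b.weight = j from hb]

/-- The root can be composed with the labels only when nothing lies above it. In positive total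
weight just the derivation terms remain, the sign counting the root and the vertices of the first
factor. -/
theorem isTwisted_mulL : IsTwisted (mulL k (PTree Gen)) (diffL k cl) (diffL k cl) (gr k cl)
    (gr k cl) (lab k) (lab k) muT where
  lab_mem t := Finsupp.single_mem_supported _ _ rfl
  inc_mem t := Finsupp.single_mem_supported _ _ rfl
  d_lab t := diffL_lab t
  d_inc t := diffL_lab t
  mul_mem i j x hx y hy := bil_mem_gr weight_muT hx hy
  d_mul_lab t e := by
    rw [lab, lab, bil_single_single, diffL_muT, diffL_single_leaf, diffL_single_leaf]
    simp [lab]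
  d_mul i j x hx y hy hij := by
    rw [← neg_one_smul k]
    refine bil_ext (f := (mulL k _).compr₂ (diffL k cl))
      (g := (-1 : k) • (mulL k _).comp (diffL k cl) +
      (-1 : k) ^ (i + 1) • (mulL k _).compl₂ (diffL k cl)) (fun a ha b hb => ?_) hx hy
    simp only [LinearMap.compr₂_apply, LinearMap.add_apply,
      LinearMap.comp_apply, LinearMap.smul_apply, LinearMap.compl₂_apply,
      bil_single_left, bil_single_right]
    have ha : a.weight = i := ha
    have hb : b.weight = j := hb
    rw [Finsupp.mapDomain_single, diffL_muT, if_neg (by omega), zero_add, ha, neg_one_smul]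

theorem diffL_bil_rhoT {i j : ℕ} {x : Tree₂ cl →₀ k} (hx : x ∈ gr k cl i) {y : Tree₂ op →₀ k}
    (hy : y ∈ gr k op j) (hij : 0 < i + j) : diffL k op (bil k rhoT x y) =
      -bil k rhoT (diffL k cl x) y + (-1 : k) ^ (i + 1) • bil k rhoT x (diffL k op y) := by
  rw [← neg_one_smul k]
  refine bil_ext (f := (bil k rhoT).compr₂ (diffL k op))
    (g := (-1 : k) • (bil k rhoT).comp (diffL k cl) +
    (-1 : k) ^ (i + 1) • (bil k rhoT).compl₂ (diffL k op)) (fun a ha b hb => ?_) hx hy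
  simp only [LinearMap.compr₂_apply, LinearMap.add_apply,
    LinearMap.comp_apply, LinearMap.smul_apply, LinearMap.compl₂_apply,
    bil_single_left, bil_single_right]
  have ha : a.weight = i := ha
  have hb : b.weight = j := hb
  rw [Finsupp.mapDomain_single, diffL_rhoT, if_neg (by omega), zero_add, ha, neg_one_smul]

theorem diffL_mapDomain_fT {i : ℕ} {x : Tree₂ cl →₀ k} (hx : x ∈ gr k cl i) (hi : 0 < i) :
    diffL k op (x.mapDomain fT) = -(diffL k cl x).mapDomain fT := by
  rw [gr, Finsupp.supported_eq_span_single] at hx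
  induction hx using Submodule.span_induction with
  | mem _ hx =>
    obtain ⟨a, ha, rfl⟩ := hx
    have ha : a.weight = i := ha
    rw [Finsupp.mapDomain_single, diffL_fT, if_neg (by omega), zero_sub]
  | zero => simp
  | add _ _ _ _ h h' =>
    rw [Finsupp.mapDomain_add, map_add, h, h', map_add, Finsupp.mapDomain_add, neg_add]
  | smul _ _ _ h =>
    rw [Finsupp.mapDomain_smul, map_smul, h, map_smul, Finsupp.mapDomain_smul, smul_neg]

variable (k) in
/-- The differential of the combinations with a marked point, which is a cycle. -/
noncomputable def diffPointed : Pointed k (PTree Gen) →ₗ[k] Pointed k (PTree Gen) :=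
  LinearMap.prodMap 0 (diffL k op)

/-- The marked point is a cycle of weight zero, and the element `f` of a label has the same
exceptional differential as `ρ` of two labels; so one structure covers both generators. -/
theorem isTwisted_actL : IsTwisted (actL k (PTree Gen)) (diffL k cl) (diffPointed k) (gr k cl)
    (grPointed k) (lab k) (inc k) act where
  lab_mem t := Finsupp.single_mem_supported _ _ rfl
  inc_mem e := by
    refine ⟨by simp, ?_⟩
    cases e with
    | none => exact Submodule.zero_mem _
    | some v => exact Finsupp.single_mem_supported _ _ rfl
  d_lab t := diffL_lab t
  d_inc e := by
    cases e with
    | none => simp [diffPointed, inc]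
    | some v => simp [diffPointed, inc, diffL_lab]
  mul_mem i j x hx y hy := by
    refine ⟨Submodule.zero_mem _, ?_⟩
    rw [actL_snd]
    refine Submodule.add_mem _ ?_ (bil_mem_gr weight_rhoT hx hy.2)
    by_cases hj : j = 0
    · subst hj
      refine Submodule.smul_mem _ _ ((Finsupp.mem_supported' _ _).2 fun t ht => ?_)
      by_cases hr : ∃ a, fT a = t
      · obtain ⟨a, rfl⟩ := hr
        rw [Finsupp.mapDomain_apply fT_injective]
        exact (Finsupp.mem_supported' _ _).1 hx _ fun h => ht (by
          change (fT a).weight = _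
          rw [weight_fT, show a.weight = i from h])
      · exact Finsupp.mapDomain_of_notMem_range _ _ hr
    · have h1 : y.1 = 0 := by simpa [hj] using hy.1
      rw [h1, zero_smul]
      exact Submodule.zero_mem _
  d_mul_lab t e := by
    refine Prod.ext (by cases e <;> simp [diffPointed, inc, act]) ?_
    change diffL k op (actL k _ (lab k t) (inc k e)).2 = _
    rw [actL_snd]
    cases e with
    | none =>
      simp only [inc, act, one_smul, map_zero, add_zero]
      rw [lab, Finsupp.mapDomain_single, diffL_fT, diffL_single_leaf]
      simp [lab]
    | some v =>
      simp only [inc, act, zero_smul, zero_add]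
      rw [lab, lab, bil_single_single, diffL_rhoT, diffL_single_leaf, diffL_single_leaf]
      simp [lab]
  d_mul i j x hx y hy hij := by
    refine Prod.ext (by simp [diffPointed]) ?_
    change diffL k op (actL k _ x y).2 = -(actL k _ (diffL k cl x) y).2 +
      (-1 : k) ^ (i + 1) • (actL k _ x (diffPointed k y)).2
    rw [actL_snd, actL_snd, actL_snd, map_add, diffL_bil_rhoT hx hy.2 hij]
    -- A marked component forces `j = 0`, hence `i > 0`, and the vertex `f` is not composed with its
    -- label.
    have h1 : diffL k op (y.1 • x.mapDomain fT) = -(y.1 • (diffL k cl x).mapDomain fT) := by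
      by_cases hj : j = 0
      · rw [map_smul, diffL_mapDomain_fT hx (by omega), smul_neg]
      · have h1 : y.1 = 0 := by simpa [hj] using hy.1
        simp [h1]
    rw [h1]
    simp only [diffPointed, LinearMap.prodMap_apply, LinearMap.zero_apply, zero_smul, zero_add]
    abel

variable {k : Type*} [Field k]

/-! ### Composition of the cogenerators with labels -/

/-- Substitution of labels. -/
noncomputable def substL (k : Type*) [Field k] (u : ℕ → (c : Colour) → PTree Gen c) (s : Colour) :
    (PTree Gen s →₀ k) →ₗ[k] (Tree₂ s →₀ k) :=
  Finsupp.lmapDomain k k fun t => t.subst fun m c => (.leaf (u m c) : Tree₂ c)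

@[simp] theorem substL_single (u : ℕ → (c : Colour) → PTree Gen c) {s : Colour} (t : PTree Gen s) :
    substL k u s (Finsupp.single t 1) =
      Finsupp.single (t.subst fun m c => (.leaf (u m c) : Tree₂ c)) 1 := by
  rw [substL, Finsupp.lmapDomain_apply, Finsupp.mapDomain_single]

/-- A closed tree of weight `i` has `i + 1` leaves, so the labels of the second factor start at `i +
1`. -/
theorem substL_mulL (u : ℕ → (c : Colour) → PTree Gen c) {i : ℕ} {x : PTree Gen cl →₀ k}
    (hx : x ∈ gr k cl i) (y : PTree Gen cl →₀ k) :
    substL k u cl (mulL k _ x y) =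
      mulL k _ (substL k u cl x) (substL k (shift (i + 1) u) cl y) := by
  refine bil_ext (f := (mulL k _).compr₂ (substL k u cl))
    (g := (mulL k _).compl₁₂ (substL k u cl) (substL k (shift (i + 1) u) cl))
    (S' := Set.univ) (fun a ha b _ => ?_) hx (by simp)
  have ha : a.weight = i := ha
  simp only [LinearMap.compr₂_apply, LinearMap.compl₁₂_apply, bil_single_single, substL_single,
    subst_muT, length_leaves_cl, ha]
  rfl

theorem substL_rhoL (u : ℕ → (c : Colour) → PTree Gen c) {i : ℕ} {x : PTree Gen cl →₀ k}
    (hx : x ∈ gr k cl i) (y : PTree Gen op →₀ k) :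
    substL k u op (bil k rhoT x y) =
      bil k rhoT (substL k u cl x) (substL k (shift (i + 1) u) op y) := by
  refine bil_ext (f := (bil k rhoT).compr₂ (substL k u op))
    (g := (bil k rhoT).compl₁₂ (substL k u cl) (substL k (shift (i + 1) u) op))
    (S' := Set.univ) (fun a ha b _ => ?_) hx (by simp)
  have ha : a.weight = i := ha
  simp only [LinearMap.compr₂_apply, LinearMap.compl₁₂_apply, bil_single_single, substL_single,
    subst_rhoT, length_leaves_cl, ha]
  rfl

theorem substL_mapDomain_fT (u : ℕ → (c : Colour) → PTree Gen c) (x : PTree Gen cl →₀ k) :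
    substL k u op (x.mapDomain fT) = (substL k u cl x).mapDomain fT := by
  simp only [substL, Finsupp.lmapDomain_apply, ← Finsupp.mapDomain_comp]
  congr 1
  funext t
  exact subst_fT t fun m c => (.leaf (u m c) : Tree₂ c)

theorem cogen_mem (n : ℕ) : cogen k n ∈ gr k cl n :=
  (Finsupp.mem_supported' _ _).2 fun t ht => by
    rw [cogen_apply, if_neg (show ¬t.weight = n from ht)]

/-- Identifies the generators of the Koszul complex with the signed sums to which
`IsTwisted.d_actSum` applies. -/
theorem substL_cogen (n : ℕ) (u : ℕ → (c : Colour) → PTree Gen c) :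
    substL k u cl (cogen k n) = assocSum (mulL k _) n (lab k ∘ fun m => u m cl) := by
  induction n using Nat.strong_induction_on generalizing u with
  | _ n ih =>
    cases n with
    | zero => simp [cogen, lab]
    | succ n =>
      rw [cogen, assocSum_succ, assocSum_succ, map_sum]
      refine Finset.sum_congr rfl fun p hp => ?_
      have := add_eq_of_mem_antidiagonal hp
      rw [shift_const, map_smul]
      change _ • substL k u cl (mulL k _ (cogen k p.1) (cogen k p.2)) = _
      rw [substL_mulL u (cogen_mem _), ih _ (by omega), ih _ (by omega)]
      rfl

/-- The end is the label of the open last input or, when there is none, the marked point. The marked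
component is kept because the recursion passes through it. -/
theorem substL_cogenOp (κ : Bool) (n : ℕ) (u : ℕ → (c : Colour) → PTree Gen c) :
    ((cogenOp k κ n).1, substL k u op (cogenOp k κ n).2) =
      actSum (mulL k _) (actL k _) n (lab k ∘ fun m => u m cl)
        (inc k (if κ then some (u n op) else none)) := by
  induction n using Nat.strong_induction_on generalizing u with
  | _ n ih =>
    cases n with
    | zero => cases κ <;> simp [cogenOp, lastFactor, inc, lab]
    | succ n =>
      have e : cogenOp k κ (n + 1) = ∑ p ∈ Finset.HasAntidiagonal.antidiagonal n,
          (-1 : k) ^ p.1 • actL k _ (cogen k p.1) (cogenOp k κ p.2) := actSum_succ _ _ _ _ _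
      have key : ∀ p ∈ Finset.HasAntidiagonal.antidiagonal n,
          (((-1 : k) ^ p.1 • actL k _ (cogen k p.1) (cogenOp k κ p.2)).1,
            substL k u op ((-1 : k) ^ p.1 • actL k _ (cogen k p.1) (cogenOp k κ p.2)).2) =
          (-1 : k) ^ p.1 • actL k _ (assocSum (mulL k _) p.1 (lab k ∘ fun m => u m cl))
            (actSum (mulL k _) (actL k _) p.2 (shift (p.1 + 1) (lab k ∘ fun m => u m cl))
              (inc k (if κ then some (u (n + 1) op) else none))) := by
        intro p hp
        have hn := add_eq_of_mem_antidiagonal hp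
        have h1 := ih p.2 (by omega) (shift (p.1 + 1) u)
        have h2 : shift (p.1 + 1) u p.2 op = u (n + 1) op := by
          simp only [shift]; congr 1; omega
        rw [h2] at h1
        have h3 : shift (p.1 + 1) (lab k ∘ fun m => u m cl) =
            lab k ∘ fun m => shift (p.1 + 1) u m cl := rfl
        rw [h3, ← h1, ← substL_cogen]
        refine Prod.ext (by simp) ?_
        simp only [Prod.smul_snd, actL_snd, map_smul, map_add, substL_mapDomain_fT,
          substL_rhoL u (cogen_mem p.1)]
      rw [e, actSum_succ]
      refine Prod.ext ?_ ?_
      · rw [Prod.fst_sum, Prod.fst_sum]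
        exact Finset.sum_congr rfl fun p hp => congrArg Prod.fst (key p hp)
      · rw [Prod.snd_sum, Prod.snd_sum, map_sum]
        exact Finset.sum_congr rfl fun p hp => congrArg Prod.snd (key p hp)

/-! ### Reading the words of right combs -/

/-- The weight of the label of a two-level tree without lower vertices. -/
def label : {s : Colour} → Tree₂ s → Option ℕ
  | _, .leaf t => some t.weight
  | _, .node _ _ => none

/-- Put a block in front of a word with a coefficient. -/
def consK (x : ℕ) (p : Bool × Word) : Bool × Word := (p.1, p.2.cons x)

/-- The word of a two-level tree whose lower tree is a right comb. -/
noncomputable def read (k : Type*) [Field k] : {s : Colour} → Tree₂ s → (Bool × Word →₀ k)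
  | _, .leaf t => Finsupp.single (lastOpen t, ([], t.weight)) 1
  | _, .node .mu t => match label (t ⟨0, by simp⟩) with
    | some x => (read k (t ⟨1, by simp⟩)).mapDomain (consK x)
    | none => 0
  | _, .node .rho t => match label (t ⟨0, by simp⟩) with
    | some x => (read k (t ⟨1, by simp⟩)).mapDomain (consK x)
    | none => 0
  | _, .node .f t => match label (t ⟨0, by simp⟩) with
    | some x => Finsupp.single (false, ([x], 0)) 1
    | none => 0

theorem read_leaf {s : Colour} (t : PTree Gen s) :
    read k (.leaf t : Tree₂ s) = Finsupp.single (lastOpen t, ([], t.weight)) 1 := by rw [read]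

theorem read_muT (a b : Tree₂ cl) : read k (muT a b) = match label a with
    | some x => (read k b).mapDomain (consK x)
    | none => 0 := by rw [muT, read]

theorem read_rhoT (a : Tree₂ cl) (v : Tree₂ op) : read k (rhoT a v) = match label a with
    | some x => (read k v).mapDomain (consK x)
    | none => 0 := by rw [rhoT, read]

theorem read_fT (a : Tree₂ cl) : read k (fT a) = match label a with
    | some x => Finsupp.single (false, ([x], 0)) 1
    | none => 0 := by rw [fT, read]

theorem label_muT (a b : Tree₂ cl) : label (muT a b) = none := by rw [muT, label]

theorem label_of_weight_pos {s : Colour} {t : Tree₂ s} (h : 0 < t.weight) : label t = none := by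
  cases t with
  | leaf x => simp at h
  | node g t => rw [label]

variable (k) in
/-- The linear extension of `read`. -/
noncomputable def readL (s : Colour) : (Tree₂ s →₀ k) →ₗ[k] (Bool × Word →₀ k) :=
  Finsupp.linearCombination k (read k)

@[simp] theorem readL_single {s : Colour} (t : Tree₂ s) :
    readL k s (Finsupp.single t 1) = read k t := by
  rw [readL, Finsupp.linearCombination_single, one_smul]

/-- Reading sees only weights and kinds of labels, which rewriting preserves. Equality of `label` is
carried along since first children are read through it. -/
theorem readL_eq_zero {s : Colour} {y : Tree₂ s →₀ k} (hy : y ∈ labIdeal k s) :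
    readL k s y = 0 := by
  refine map_eq_zero_of_mem_labIdeal (readL k s) (fun c C t t' h => ?_) hy
  obtain ⟨h1, h2⟩ := h.weight_eq_and_lastOpen_eq
  rw [readL_single, readL_single]
  refine (plug_rel (R := fun a a' => read k a = read k a' ∧ label a = label a')
    ?_ ?_ ?_ ?_ ?_ C (w := .leaf t) (w' := .leaf t') ⟨?_, ?_⟩).1
  · rintro a a' b ⟨h1, h2⟩
    exact ⟨by rw [read_muT, read_muT, h2], by rw [label_muT, label_muT]⟩
  · rintro a b b' ⟨h1, h2⟩
    exact ⟨by rw [read_muT, read_muT, h1], by rw [label_muT, label_muT]⟩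
  · rintro a a' b ⟨h1, h2⟩
    exact ⟨by rw [read_rhoT, read_rhoT, h2],
      by rw [label_of_weight_pos, label_of_weight_pos] <;> simp⟩
  · rintro a b b' ⟨h1, h2⟩
    exact ⟨by rw [read_rhoT, read_rhoT, h1],
      by rw [label_of_weight_pos, label_of_weight_pos] <;> simp⟩
  · rintro a a' ⟨h1, h2⟩
    exact ⟨by rw [read_fT, read_fT, h2], by rw [label_of_weight_pos, label_of_weight_pos] <;> simp⟩
  · rw [read_leaf, read_leaf, h1, h2]
  · rw [label, label, h1]

/-- A linear map that kills products by elements of positive weight only sees the first label. -/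
theorem map_actSum_succ {M N T : Type*} [AddCommGroup M] [Module k M] [AddCommGroup N] [Module k N]
    {A : Type*} [AddCommGroup A] [Module k A]
    {mulA : A →ₗ[k] A →ₗ[k] A} {mul : A →ₗ[k] M →ₗ[k] M} {dA : A →ₗ[k] A}
    {GA : ℕ → Submodule k A} {lab : T → A} {c : T → T → T}
    (hA : IsTwisted mulA dA dA GA GA lab lab c) (F : M →ₗ[k] N)
    (hF : ∀ i, ∀ x ∈ GA i, 0 < i → ∀ y, F (mul x y) = 0) (n : ℕ) (t : ℕ → T) (e : M) :
    F (actSum mulA mul (n + 1) (lab ∘ t) e) =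
      F (mul (lab (t 0)) (actSum mulA mul n (lab ∘ shift 1 t) e)) := by
  rw [actSum_succ, map_sum, Finset.sum_eq_single (0, n)]
  · simp; rfl
  · intro p hp hne
    have := add_eq_of_mem_antidiagonal hp
    rw [map_smul, hF p.1 _ (hA.assocSum_mem _ _), smul_zero]
    refine Nat.pos_of_ne_zero fun h0 => hne (Prod.ext h0 ?_)
    simp only; omega
  · intro h
    simp at h

theorem map_bil_eq_zero {X : Colour → Type} {s s' s'' : Colour} {N : Type*} [AddCommGroup N]
    [Module k N] {φ : Tree Gen X s → Tree Gen X s' → Tree Gen X s''}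
    (F : (Tree Gen X s'' →₀ k) →ₗ[k] N) {i : ℕ}
    (hF : ∀ a b, a.weight = i → F (Finsupp.single (φ a b) 1) = 0) {x : Tree Gen X s →₀ k}
    (hx : x ∈ gr k s i) (y : Tree Gen X s' →₀ k) : F (bil k φ x y) = 0 :=
  bil_ext (f := (bil k φ).compr₂ F) (g := 0) (S' := Set.univ)
    (fun a ha b _ => by
      rw [LinearMap.compr₂_apply, bil_single_single]
      exact hF a b ha) hx (by simp)

theorem readL_mulL_lab (a : PTree Gen cl) (y : Tree₂ cl →₀ k) :
    readL k cl (mulL k _ (lab k a) y) = (readL k cl y).mapDomain (consK a.weight) := by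
  rw [lab, bil_single_left]
  induction y using Finsupp.induction_linear with
  | zero => simp
  | add x y hx hy => rw [Finsupp.mapDomain_add, map_add, hx, hy, map_add, Finsupp.mapDomain_add]
  | single t r =>
    rw [← mul_one r, ← smul_eq_mul, ← Finsupp.smul_single, Finsupp.mapDomain_smul, map_smul,
      map_smul, Finsupp.mapDomain_smul, Finsupp.mapDomain_single, readL_single, readL_single,
      read_muT, label]

theorem readL_rhoL_lab (a : PTree Gen cl) (y : Tree₂ op →₀ k) :
    readL k op (bil k rhoT (lab k a) y) = (readL k op y).mapDomain (consK a.weight) := by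
  rw [lab, bil_single_left]
  induction y using Finsupp.induction_linear with
  | zero => simp
  | add x y hx hy => rw [Finsupp.mapDomain_add, map_add, hx, hy, map_add, Finsupp.mapDomain_add]
  | single t r =>
    rw [← mul_one r, ← smul_eq_mul, ← Finsupp.smul_single, Finsupp.mapDomain_smul, map_smul,
      map_smul, Finsupp.mapDomain_smul, Finsupp.mapDomain_single, readL_single, readL_single,
      read_rhoT, label]

/-- Products whose first factor has positive weight read as zero, so only the right comb survives;
all its signs are `(-1) ^ 0`. -/
theorem readL_actSum_cl (l : List ℕ) (t : ℕ → PTree Gen cl) (e : PTree Gen cl)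
    (ht : ∀ m < l.length, (t m).weight = l.getD m 0) :
    readL k cl (actSum (mulL k _) (mulL k _) l.length (lab k ∘ t) (lab k e)) =
      Finsupp.single (true, (l, e.weight)) 1 := by
  induction l generalizing t with
  | nil => simp [lab, read_leaf, lastOpen_cl]
  | cons x l ih =>
    rw [List.length_cons, map_actSum_succ isTwisted_mulL, readL_mulL_lab, ih]
    · have h0 := ht 0 (by simp)
      simp only [List.getD_cons_zero] at h0
      rw [Finsupp.mapDomain_single, consK, Word.cons, h0]
    · intro m hm
      have := ht (m + 1) (by simpa using hm)
      simp only [List.getD_cons_succ] at this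
      rw [shift, add_comm, this]
    · intro i x hx hi y
      refine map_bil_eq_zero _ (fun a b ha => ?_) hx y
      rw [readL_single, read_muT, label_of_weight_pos (ha ▸ hi)]

variable (k) in
/-- The extension of `readL` to the combinations with a marked point. -/
noncomputable def readPointed : Pointed k (PTree Gen) →ₗ[k] (Bool × Word →₀ k) :=
  LinearMap.coprod (Finsupp.lsingle (false, ([], 0))) (readL k op)

theorem readPointed_apply (y : Pointed k (PTree Gen)) : readPointed k y =
    Finsupp.single (false, ([], 0)) y.1 + readL k op y.2 := rfl

theorem readPointed_actL_lab (a : PTree Gen cl) (y : Pointed k (PTree Gen)) :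
    readPointed k (actL k _ (lab k a) y) = (readPointed k y).mapDomain (consK a.weight) := by
  rw [readPointed_apply, readPointed_apply, actL_snd, actL_fst, Finsupp.mapDomain_add, map_add,
    readL_rhoL_lab, map_smul, lab, Finsupp.mapDomain_single, readL_single, read_fT, label,
    Finsupp.mapDomain_single]
  simp [consK, Word.cons]

/-- The marked point is read as an empty word of kind `false`, so that prefixing a block accounts
for `f` as well as for `ρ`. -/
theorem readPointed_actSum (l : List ℕ) (t : ℕ → PTree Gen cl) (e : End)
    (ht : ∀ m < l.length, (t m).weight = l.getD m 0) :
    readPointed k (actSum (mulL k _) (actL k _) l.length (lab k ∘ t) (inc k e)) =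
      Finsupp.single (e.lastOpen, (l, e.weight)) 1 := by
  induction l generalizing t with
  | nil => cases e <;> simp [readPointed_apply, inc, lab, read_leaf, End.lastOpen, End.weight]
  | cons x l ih =>
    rw [List.length_cons, map_actSum_succ isTwisted_mulL, readPointed_actL_lab, ih]
    · have h0 := ht 0 (by simp)
      simp only [List.getD_cons_zero] at h0
      rw [Finsupp.mapDomain_single, consK, Word.cons, h0]
    · intro m hm
      have := ht (m + 1) (by simpa using hm)
      simp only [List.getD_cons_succ] at this
      rw [shift, add_comm, this]
    · intro i x hx hi y
      rw [readPointed_apply, actL_fst, actL_snd, map_add, map_smul,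
        map_bil_eq_zero (readL k op) (fun a b ha => ?_) hx y.2]
      · have : readL k op (x.mapDomain fT) = 0 := by
          rw [gr, Finsupp.supported_eq_span_single] at hx
          induction hx using Submodule.span_induction with
          | mem _ hx =>
            obtain ⟨a, ha, rfl⟩ := hx
            rw [Finsupp.mapDomain_single, readL_single, read_fT,
              label_of_weight_pos (hi.trans_eq (show a.weight = i from ha).symm)]
          | zero => simp
          | add _ _ _ _ h h' => rw [Finsupp.mapDomain_add, map_add, h, h', add_zero]
          | smul _ _ _ h => rw [Finsupp.mapDomain_smul, map_smul, h, smul_zero]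
        simp [this]
      · rw [readL_single, read_rhoT, label_of_weight_pos (ha ▸ hi)]

/-! ### The Koszul complex as a complex of words. -/

section

variable (k : Type*) [Field k]

/-- The composite product of the cofree cooperad and the operad. -/
abbrev Comp₁ (s : Colour) : Type _ := (Tree₂ s →₀ k) ⧸ labIdeal k s

/-- The differential of the composite product. -/
noncomputable def diffC (s : Colour) : Comp₁ k s →ₗ[k] Comp₁ k s := (hsc₁ k).diff s

/-- The Koszul complex. -/
noncomputable def koszul (s : Colour) : Submodule k (Comp₁ k s) := (hsc₁ k).koszulComplex s

/-- The element of the Koszul complex with closed output of a word. -/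
noncomputable def wordCl (w : Word) : Tree₂ cl →₀ k :=
  actSum (mulL k _) (mulL k _) w.1.length (lab k ∘ fun m => comb (w.1.getD m 0)) (lab k (comb w.2))

/-- The element of the Koszul complex with open output of a word. -/
noncomputable def wordOp (p : Bool × Word) : Tree₂ op →₀ k :=
  (actSum (mulL k _) (actL k _) p.2.1.length (lab k ∘ fun m => comb (p.2.1.getD m 0))
    (inc k (End.comb p.1 p.2.2))).2

/-- The linear extension of `wordCl`. -/
noncomputable def wordClL : (Unit × Word →₀ k) →ₗ[k] Comp₁ k cl :=
  Finsupp.linearCombination k fun p => (labIdeal k cl).mkQ (wordCl k p.2)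

/-- The linear extension of `wordOp`. -/
noncomputable def wordOpL : (Bool × Word →₀ k) →ₗ[k] Comp₁ k op :=
  Finsupp.linearCombination k fun p => (labIdeal k op).mkQ (wordOp k p)

end

variable {k : Type*} [Field k]

@[simp] theorem weight_comb (n : ℕ) : (comb n).weight = n := by
  induction n with
  | zero => rfl
  | succ n ih => rw [comb, weight_muT, ih, one, weight_leaf, zero_add]

theorem weight_act (a : PTree Gen cl) (e : End) : (act a e).weight = a.weight + e.weight + 1 := by
  cases e <;> simp [act, End.weight]

theorem lastOpen_act (a : PTree Gen cl) (e : End) : (act a e).lastOpen = e.lastOpen := by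
  cases e <;> simp [act, End.lastOpen]

@[simp] theorem End.weight_comb (κ : Bool) (n : ℕ) : (End.comb κ n).weight = n := by
  induction n with
  | zero => cases κ <;> rfl
  | succ n ih => rw [End.comb, weight_act, ih, one, weight_leaf, zero_add]

@[simp] theorem End.lastOpen_comb (κ : Bool) (n : ℕ) : (End.comb κ n).lastOpen = κ := by
  induction n with
  | zero => cases κ <;> simp [End.comb, End.lastOpen, one]
  | succ n ih => rw [End.comb, lastOpen_act, ih]

theorem lab_sub_mem (t : PTree Gen cl) {n : ℕ} (h : t.weight = n) :
    lab k t - lab k (comb n) ∈ labIdeal k cl :=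
  h ▸ (rot_comb t).leaf_sub_mem

/-- Modulo the ideal every label may be replaced by the comb of its weight, and the products respect
the ideal. -/
theorem mkQ_actSum_cl {n : ℕ} (w : Word) (t : ℕ → PTree Gen cl) (e : PTree Gen cl)
    (hn : w.1.length = n) (ht : ∀ m < n, (t m).weight = w.1.getD m 0) (he : e.weight = w.2) :
    (labIdeal k cl).mkQ (actSum (mulL k _) (mulL k _) n (lab k ∘ t) (lab k e)) =
      (labIdeal k cl).mkQ (wordCl k w) := by
  subst hn
  refine (Submodule.Quotient.eq _).2 (actSum_sub_mem (mulL k _) (mulL k _)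
    (fun x hx y => mulL_mem_left hx y) (fun x y hy => mulL_mem_right x hy)
    (fun x hx y => mulL_mem_left hx y)
    (fun x y hy => mulL_mem_right x hy) _ _ _ _ _ (fun m hm => ?_) (lab_sub_mem e he))
  exact lab_sub_mem _ (ht m hm)

theorem mkQ_actSum_op {n : ℕ} (p : Bool × Word) (t : ℕ → PTree Gen cl) (e : End)
    (hn : p.2.1.length = n) (ht : ∀ m < n, (t m).weight = p.2.1.getD m 0)
    (he : e.weight = p.2.2) (hκ : e.lastOpen = p.1) :
    (labIdeal k op).mkQ (actSum (mulL k _) (actL k _) n (lab k ∘ t) (inc k e)).2 =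
      (labIdeal k op).mkQ (wordOp k p) := by
  subst hn
  have h : inc k e - inc k (End.comb p.1 p.2.2) ∈ pointedIdeal k := by
    rw [← he, ← hκ]
    exact inc_sub_mem (rel_comb e)
  refine (Submodule.Quotient.eq _).2 (actSum_sub_mem (mulL k _) (actL k _)
    (fun x hx y => mulL_mem_left hx y)
    (fun x y hy => mulL_mem_right x hy) (fun x hx y => actL_mem_left hx y)
    (fun x y hy => actL_mem_right x hy) _ _ _ _ _ (fun m hm => ?_) h).2
  exact lab_sub_mem _ (ht m hm)

theorem weight_mergeAt {i : ℕ} {l : List ℕ} (m : ℕ) :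
    (mergeAt muT i (fun m => comb (l.getD m 0)) m).weight =
      mergeAt (fun x y => x + y + 1) i (fun m => l.getD m 0) m := by
  simp only [mergeAt]
  split_ifs <;> simp

theorem diffC_mkQ {s : Colour} (x : Tree₂ s →₀ k) :
    diffC k s ((labIdeal k s).mkQ x) = (labIdeal k s).mkQ (diffL k s x) := rfl

/-- Multiplying two labels adds their weights and one, as `Word.merge` does. The summand in which
the end changes is the merge with the last block. -/
theorem diffC_wordCl (l : List ℕ) (j : ℕ) : diffC k cl ((labIdeal k cl).mkQ (wordCl k (l, j))) =
    ∑ i ∈ Finset.range l.length,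
      (-1 : k) ^ i • (labIdeal k cl).mkQ (wordCl k (Word.merge i l j)) := by
  rw [diffC_mkQ]
  obtain ⟨n, hn⟩ | hl : (∃ n, l.length = n + 1) ∨ l = [] := by cases l <;> simp
  · rw [wordCl]
    simp only [hn]
    rw [isTwisted_mulL.d_actSum isTwisted_mulL, map_add, map_sum, Finset.sum_range_succ]
    congr 1
    · refine Finset.sum_congr rfl fun i hi => ?_
      obtain ⟨h1, h2, h3⟩ := Word.merge_lt (i := i) (l := l) j (by rw [hn]; simpa using hi)
      rw [map_smul, mkQ_actSum_cl (Word.merge i l j) _ _ (by omega)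
        (fun m _ => by rw [weight_mergeAt, h3]) (by rw [weight_comb, h2])]
    · obtain ⟨h1, h2, h3⟩ := Word.merge_last l n j hn.symm
      rw [map_smul, mkQ_actSum_cl (Word.merge n l j) _ _ h1
        (fun m hm => by rw [weight_comb, h3 m hm]) (by simp [h2])]
  · subst hl
    simp [wordCl, diffL_lab]

theorem diffC_wordOp (κ : Bool) (l : List ℕ) (j : ℕ) :
    diffC k op ((labIdeal k op).mkQ (wordOp k (κ, (l, j)))) =
    ∑ i ∈ Finset.range l.length,
      (-1 : k) ^ i • (labIdeal k op).mkQ (wordOp k (κ, Word.merge i l j)) := by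
  rw [diffC_mkQ]
  have h : diffL k op (wordOp k (κ, (l, j))) = (diffPointed k (actSum (mulL k _) (actL k _) l.length
    (lab k ∘ fun m => comb (l.getD m 0)) (inc k (End.comb κ j)))).2 := rfl
  rw [h]
  obtain ⟨n, hn⟩ | hl : (∃ n, l.length = n + 1) ∨ l = [] := by cases l <;> simp
  · simp only [hn]
    rw [isTwisted_mulL.d_actSum isTwisted_actL, Prod.snd_add, Prod.snd_sum, map_add, map_sum,
      Finset.sum_range_succ]
    congr 1
    · refine Finset.sum_congr rfl fun i hi => ?_
      obtain ⟨h1, h2, h3⟩ := Word.merge_lt (i := i) (l := l) j (by rw [hn]; simpa using hi)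
      rw [Prod.smul_snd, map_smul, mkQ_actSum_op (κ, Word.merge i l j) _ _ (by simp only; omega)
        (fun m _ => by rw [weight_mergeAt, h3]) (by rw [End.weight_comb, h2]) (by simp)]
    · obtain ⟨h1, h2, h3⟩ := Word.merge_last l n j hn.symm
      rw [Prod.smul_snd, map_smul, mkQ_actSum_op (κ, Word.merge n l j) _ _ h1
        (fun m hm => by rw [weight_comb, h3 m hm]) (by simp [h2, weight_act])
        (by simp [lastOpen_act])]
  · subst hl
    rw [List.length_nil, actSum_zero, isTwisted_actL.d_inc]
    simp

theorem koszul_eq_span (s : Colour) : koszul k s =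
    Submodule.span k {y | ∃ (I : List Colour), ∃ x ∈ dual k I s,
      ∃ u : ℕ → (c : Colour) → PTree Gen c, y = (labIdeal k s).mkQ (substL k u s x)} := rfl

theorem eq_zero_of_mem_dual {I : List Colour} {s : Colour} {x : PTree Gen s →₀ k}
    (hx : x ∈ dual k I s) (h : ¬∃ t : PTree Gen s, t.leaves = I) : x = 0 := by
  ext t
  by_contra ht
  exact h ⟨t, (mem_koszulDual_iff.1 hx).1 t ht⟩

theorem getD_map_range (n : ℕ) (f : ℕ → ℕ) {m : ℕ} (hm : m < n) :
    ((List.range n).map f).getD m 0 = f m := by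
  simp [List.getD, hm]

/-- A generator is a scalar times a signed sum with labels, hence a scalar times the word of its
label weights; conversely, combs as labels realize every word. -/
theorem koszul_cl : koszul k cl =
    Submodule.map (wordClL k) (Finsupp.supported k k (Word.valid ())) := by
  rw [koszul_eq_span, Finsupp.supported_eq_span_single, Submodule.map_span]
  apply le_antisymm
  · refine Submodule.span_le.2 ?_
    rintro _ ⟨I, x, hx, u, rfl⟩
    by_cases h : ∃ t : PTree Gen cl, t.leaves = I
    · obtain ⟨t, ht⟩ := h
      rw [eq_smul_of_mem_koszulDual hx t ht (y := cogen k t.weight)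
        (fun t' => by simp [cogen_apply, lastOpen_cl]), map_smul, map_smul]
      refine Submodule.smul_mem _ _ (Submodule.subset_span ⟨_, ⟨((), ((List.range t.weight).map
        fun m => (u m cl).weight, (u t.weight cl).weight)), fun _ => rfl, rfl⟩, ?_⟩)
      rw [wordClL, Finsupp.linearCombination_single, one_smul, substL_cogen, assocSum_eq_actSum]
      exact (mkQ_actSum_cl _ _ _ (by simp) (fun m hm =>
        (getD_map_range t.weight (fun m => (u m cl).weight) hm).symm) rfl).symm
    · rw [eq_zero_of_mem_dual hx h, map_zero, map_zero]
      exact Submodule.zero_mem _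
  · refine Submodule.span_le.2 ?_
    rintro _ ⟨_, ⟨⟨_, w⟩, -, rfl⟩, rfl⟩
    refine Submodule.subset_span ⟨List.replicate (w.1.length + 1) cl, cogen k w.1.length,
      mem_koszulDual_of_apply w.1.length true _ (fun t h _ => by rw [leaves_cl, h])
        (fun t => by simp [cogen_apply, lastOpen_cl]),
      fun m c => match c with
        | cl => if m < w.1.length then comb (w.1.getD m 0) else comb w.2
        -- There are no open leaves here, so this value is arbitrary.
        | op => one op, ?_⟩
    rw [wordClL, Finsupp.linearCombination_single, one_smul, substL_cogen, assocSum_eq_actSum]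
    exact (mkQ_actSum_cl _ _ _ rfl (fun m hm => by simp [hm]) (by simp)).symm

theorem koszul_op : koszul k op =
    Submodule.map (wordOpL k) (Finsupp.supported k k (Word.valid true)) := by
  have hsub (κ : Bool) (n : ℕ) (u : ℕ → (c : Colour) → PTree Gen c) :
      substL k u op (cogenOp k κ n).2 = (actSum (mulL k _) (actL k _) n (lab k ∘ fun m => u m cl)
        (inc k (if κ then some (u n op) else none))).2 :=
    congrArg Prod.snd (substL_cogenOp κ n u)
  rw [koszul_eq_span, Finsupp.supported_eq_span_single, Submodule.map_span]
  apply le_antisymm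
  · refine Submodule.span_le.2 ?_
    rintro _ ⟨I, x, hx, u, rfl⟩
    by_cases h : ∃ t : PTree Gen op, t.leaves = I
    · obtain ⟨t, ht⟩ := h
      rw [eq_smul_of_mem_koszulDual hx t ht (y := (cogenOp k (lastOpen t) t.weight).2)
        (cogenOp_apply _ _).2, map_smul, map_smul, hsub]
      set e : End := if lastOpen t then some (u t.weight op) else none with he
      refine Submodule.smul_mem _ _ (Submodule.subset_span ⟨_, ⟨(e.lastOpen,
        ((List.range t.weight).map fun m => (u m cl).weight, e.weight)), fun h0 => ?_, rfl⟩, ?_⟩)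
      -- For the empty word the lower tree and its end are both trivial. The trivial lower tree has
      -- an open input, so the end is the identity of the open colour, not the marked point.
      · obtain ⟨h1, h2⟩ := Prod.ext_iff.1 h0
        have h1 : t.weight = 0 := by simpa using h1
        obtain ⟨x, rfl⟩ : ∃ x, t = .leaf x := ⟨PUnit.unit, eq_one_of_weight_eq_zero h1⟩
        simp only [lastOpen_leaf, if_true] at he
        rw [he] at h2 ⊢
        change lastOpen _ = true
        rw [eq_one_of_weight_eq_zero h2, one, lastOpen_leaf]
      · rw [wordOpL, Finsupp.linearCombination_single, one_smul]
        exact (mkQ_actSum_op _ _ _ (by simp) (fun m hm =>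
        (getD_map_range t.weight (fun m => (u m cl).weight) hm).symm) rfl
          rfl).symm
    · rw [eq_zero_of_mem_dual hx h, map_zero, map_zero]
      exact Submodule.zero_mem _
  · refine Submodule.span_le.2 ?_
    rintro _ ⟨_, ⟨⟨κ, w⟩, hv, rfl⟩, rfl⟩
    -- The kind `κ'` of the lower tree may differ from the kind `κ` of the composite: if `κ` is
    -- `false` but the last block is positive, then `f` sits in the label `v` and the lower tree has
    -- an open last input.
    obtain ⟨κ', v, hv⟩ : ∃ (κ' : Bool) (v : PTree Gen op),
        End.comb κ w.2 = if κ' then some v else none := by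
      cases End.comb κ w.2 with
      | none => exact ⟨false, one op, rfl⟩
      | some v => exact ⟨true, v, rfl⟩
    refine Submodule.subset_span ⟨List.replicate w.1.length cl ++ if κ' then [op] else [],
      (cogenOp k κ' w.1.length).2,
      mem_koszulDual_of_apply w.1.length κ' _ (fun t h h' => by rw [leaves_op, h, h'])
        (cogenOp_apply _ _).2,
      fun m c => match c with
        | cl => comb (w.1.getD m 0)
        | op => v, ?_⟩
    rw [wordOpL, Finsupp.linearCombination_single, one_smul, hsub]
    exact (mkQ_actSum_op _ _ _ rfl (fun m _ => by simp) (by simp [← hv]) (by simp [← hv])).symm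

/-! ### Independence of the words, and acyclicity. -/

variable (k) in
/-- Reading words with closed output. -/
noncomputable def readCl : Comp₁ k cl →ₗ[k] (Unit × Word →₀ k) :=
  (labIdeal k cl).liftQ (Finsupp.lmapDomain k k (fun p => ((), p.2)) ∘ₗ readL k cl) fun x hx => by
    rw [LinearMap.mem_ker, LinearMap.comp_apply, readL_eq_zero hx, map_zero]

variable (k) in
/-- Reading words with open output. -/
noncomputable def readOp : Comp₁ k op →ₗ[k] (Bool × Word →₀ k) :=
  (labIdeal k op).liftQ (readL k op) fun _ hx => readL_eq_zero hx

theorem readCl_wordClL (p : Unit × Word) :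
    readCl k (wordClL k (Finsupp.single p 1)) = Finsupp.single p 1 := by
  rw [wordClL, Finsupp.linearCombination_single, one_smul]
  change Finsupp.lmapDomain k k (fun p => ((), p.2)) (readL k cl (wordCl k p.2)) = _
  rw [wordCl, readL_actSum_cl _ _ _ (fun m _ => weight_comb _)]
  simp

theorem actSum_fst (n : ℕ) (u : ℕ → Tree₂ cl →₀ k) (y : Pointed k (PTree Gen)) :
    (actSum (mulL k _) (actL k _) (n + 1) u y).1 = 0 := by
  rw [actSum_succ, Prod.fst_sum]
  exact Finset.sum_eq_zero fun p _ => by simp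

/-- `readOp` ignores the marked component. That component is nonzero only for the bare marked point,
which is the word excluded by validity. -/
theorem readOp_wordOpL (p : Bool × Word) (hp : p ∈ Word.valid true) :
    readOp k (wordOpL k (Finsupp.single p 1)) = Finsupp.single p 1 := by
  obtain ⟨κ, l, j⟩ := p
  have h := readPointed_actSum (k := k) l (fun m => comb (l.getD m 0)) (End.comb κ j)
    fun m _ => weight_comb _
  have h0 : (actSum (mulL k _) (actL k _) l.length (lab k ∘ fun m => comb (l.getD m 0))
      (inc k (End.comb κ j))).1 = 0 := by
    match l, j, κ, hp with
    | x :: l, j, κ, _ => exact actSum_fst _ _ _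
    | [], 0, true, _ => rw [List.length_nil, actSum_zero]; rfl
    | [], 0, false, hp => exact absurd (hp rfl) (by simp)
    | [], j + 1, κ, _ =>
      rw [List.length_nil, actSum_zero, End.comb]
      cases End.comb κ j <;> rfl
  rw [readPointed_apply, h0, Finsupp.single_zero, zero_add, End.lastOpen_comb, End.weight_comb] at h
  rw [wordOpL, Finsupp.linearCombination_single, one_smul]
  exact h

/-- The operad of affine actions is Koszul. -/
theorem isKoszul (k : Type*) [Field k] : (hsc₁ k).IsKoszul := by
  intro s z hz hd
  cases s with
  | cl =>
    refine Word.existsUnique_of_basis () (diffC k cl) (koszul k cl) ((hsc₁ k).unit cl) (wordClL k)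
      (readCl k) koszul_cl (fun p _ => readCl_wordClL p) ?_ ?_ z hz hd
    · rintro ⟨_, l, j⟩ -
      rw [wordClL, Finsupp.linearCombination_single, one_smul, diffC_wordCl, Word.d,
        Finsupp.linearCombination_single, one_smul, map_sum]
      simp [Finsupp.linearCombination_single]
    · rw [wordClL, Finsupp.linearCombination_single, one_smul]
      simp [wordCl]
      rfl
  | op =>
    refine Word.existsUnique_of_basis true (diffC k op) (koszul k op) ((hsc₁ k).unit op)
      (wordOpL k) (readOp k) koszul_op readOp_wordOpL ?_ ?_ z hz hd
    · rintro ⟨κ, l, j⟩ -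
      rw [wordOpL, Finsupp.linearCombination_single, one_smul, diffC_wordOp, Word.d,
        Finsupp.linearCombination_single, one_smul, map_sum]
      simp [Finsupp.linearCombination_single]
    · rw [wordOpL, Finsupp.linearCombination_single, one_smul]
      simp [wordOp]
      rfl

end HSC₁

end NSKoszul

/-- The non-symmetric two-coloured operad `hsc₁` of affine actions is Koszul. -/
theorem propositionP (k : Type*) [Field k] : (NSKoszul.hsc₁ k).IsKoszul :=
  NSKoszul.HSC₁.isKoszul k
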